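/- Let $d\ge 0$ be an integer, $0<\mu_f\le L_f$, $0<\mu_\phi\le L_\phi$ and $\eta>0$. For $\mu\le L$ let $S(\mu,L)$ be the set of continuously differentiable $h:\mathbb R^d\to\mathbb R$ with $\mu\|x-y\|^2\le(\nabla h(x)-\nabla h(y))^T(x-y)\le L\|x-y\|^2$ for all $x,y$. Let $f\in S(\mu_f,L_f)$, $\phi\in S(\mu_\phi,L_\phi)$, let $\bar\phi(z)=\sup_x\{x^Tz-\phi(x)\}$ be the convex conjugate of $\phi$, and put $\mu_{\bar\phi}=L_\phi^{-1}$. Then $f$ has a unique minimizer $x^{\rm opt}$ over $\mathbb R^d$, there is a unique $z^{\rm opt}$ with $\nabla f(\nabla\bar\phi(z^{\rm opt}))=0$, and $x^{\rm opt}=\nabla\bar\phi(z^{\rm opt})$. Moreover, the following hold. (1) Let $G$ be the causal linear time-invariant operator (with zero initial state) with transfer function $$G(s)=C(sI-A)^{-1}B+D=\frac{1}{s+\eta\mu_f\mu_{\bar\phi}}\begin{bmatrix}-\eta\mu_{\bar\phi}&s\\-\eta&-\eta\mu_f\end{bmatrix}\otimes I_d,$$ where $A=-\eta\mu_f\mu_{\bar\phi}I_d$,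 $B=\begin{bmatrix}-\eta I_d&-\eta\mu_fI_d\end{bmatrix}$, $C=\begin{bmatrix}\mu_{\bar\phi}I_d\\I_d\end{bmatrix}$, $D=\begin{bmatrix}0&I_d\\0&0\end{bmatrix}$; that is, $(Gw)(t)=Dw(t)+\int_0^tCe^{(t-s)A}Bw(s)\,ds$. Let $\Delta$ be the static operator $(\Delta v)(t)=(\Delta_1(v_1(t)),\Delta_2(v_2(t)))$, where $$\Delta_1(x)=\big(\nabla f(x+x^{\rm opt})-\mu_f(x+x^{\rm opt})\big)-\big(\nabla f(x^{\rm opt})-\mu_fx^{\rm opt}\big),$$ $$\Delta_2(x)=\big(\nabla\bar\phi(x+z^{\rm opt})-\mu_{\bar\phi}(x+z^{\rm opt})\big)-\big(\nabla\bar\phi(z^{\rm opt})-\mu_{\bar\phi}z^{\rm opt}\big).$$ Then the interconnection $v=Gw+g$, $w=\Delta(v)+e$ is stable. This means: $G$ and $\Delta$ are causal operators on the space $\mathbf L_{2e}^{2d}[0,\infty)$ of functions that are square integrable on bounded intervals; the map $(v,w)\mapsto(g,e)$ has a causal inverse on $\mathbf L_{2e}^{4d}[0,\infty)$; and there is $c>0$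 such that $\int_0^T(|v|^2+|w|^2)\,dt\le c\int_0^T(|g|^2+|e|^2)\,dt$ for all $T\ge0$ and all $g,e\in\mathbf L_{2e}^{2d}[0,\infty)$ (in particular for $g,e\in\mathbf L_2$, where then $v,w\in\mathbf L_2$). (2) For every $z_0\in\mathbb R^d$ the continuous-time mirror descent equation $\dot z(t)=-\eta\nabla f(\nabla\bar\phi(z(t)))$, $z(0)=z_0$, has a unique solution on $[0,\infty)$, and $x(t)=\nabla\bar\phi(z(t))\to x^{\rm opt}$ as $t\to\infty$. -/

import Mathlib

open MeasureTheory Set Filter Topology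

noncomputable section

namespace MirrorDescent

/-! ### Smooth strongly convex functions and the convex conjugate -/

/-- The class `S(μ, L)` of continuously differentiable functions on a Euclidean space with
`μ ‖x - y‖² ≤ ⟨∇f x - ∇f y, x - y⟩ ≤ L ‖x - y‖²` for all `x, y`. -/
structure ClassS {E : Type*} [NormedAddCommGroup E] [InnerProductSpace ℝ E] [CompleteSpace E]
    (μ L : ℝ) (f : E → ℝ) : Prop where
  contDiff : ContDiff ℝ 1 f
  lower : ∀ x y : E, μ * ‖x - y‖ ^ 2 ≤ inner ℝ (gradient f x - gradient f y) (x - y)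
  upper : ∀ x y : E, inner ℝ (gradient f x - gradient f y) (x - y) ≤ L * ‖x - y‖ ^ 2

/-- The convex conjugate `φ̄(z) = sup_x (⟨x, z⟩ - φ x)`. -/
def conjugate {E : Type*} [NormedAddCommGroup E] [InnerProductSpace ℝ E]
    (φ : E → ℝ) (z : E) : ℝ :=
  ⨆ x : E, (inner ℝ x z - φ x)

/-! ### Signals, causal operators, feedback interconnections

A signal on `[0, ∞)` is represented by a function on `ℝ` whose values at negative times are
irrelevant; signals are compared almost everywhere on `[0, ∞)`. -/

/-- Membership in the extended space `L₂ₑ[0, ∞)`: square integrable on every `[0, T]`. -/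
def IsL2e {E : Type*} [NormedAddCommGroup E] (f : ℝ → E) : Prop :=
  ∀ T : ℝ, MemLp f 2 (volume.restrict (Icc 0 T))

/-- Equality of signals: almost everywhere on `[0, ∞)`. -/
def SigEq {E : Type*} (f g : ℝ → E) : Prop :=
  f =ᵐ[volume.restrict (Ici 0)] g

/-- The truncation `P_T`: unchanged up to time `T`, zero on `(T, ∞)`. -/
def trunc {E : Type*} [Zero E] (T : ℝ) (f : ℝ → E) : ℝ → E :=
  (Iic T).indicator f

/-- `H` is (a representative of) a causal operator from `L₂ₑ` to `L₂ₑ`: it maps `L₂ₑ` to `L₂ₑ`,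
respects almost everywhere equality, and satisfies `P_T H P_T = P_T H` for all `T ≥ 0`. -/
structure IsCausalOperator {E F : Type*} [NormedAddCommGroup E] [NormedAddCommGroup F]
    (H : (ℝ → E) → (ℝ → F)) : Prop where
  mapsTo : ∀ f, IsL2e f → IsL2e (H f)
  congr : ∀ f g, IsL2e f → IsL2e g → SigEq f g → SigEq (H f) (H g)
  causal : ∀ f, IsL2e f → ∀ T : ℝ, 0 ≤ T → SigEq (trunc T (H (trunc T f))) (trunc T (H f))

/-- The map `(v, w) ↦ (g, e)` defined by the feedback interconnection
`v = G w + g`, `w = Δ v + e`. A pair of signals is a signal with values in the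
Euclidean product, so that `‖(v t, w t)‖² = ‖v t‖² + ‖w t‖²`. -/
def loopMap {V W : Type*} [NormedAddCommGroup V] [NormedAddCommGroup W]
    (G : (ℝ → W) → (ℝ → V)) (Δ : (ℝ → V) → (ℝ → W))
    (p : ℝ → WithLp 2 (V × W)) : ℝ → WithLp 2 (V × W) := fun t =>
  WithLp.toLp 2
    ((p t).fst - G (fun s => (p s).snd) t, (p t).snd - Δ (fun s => (p s).fst) t)

/-- `R` is a causal inverse on `L₂ₑ` of the map `(v, w) ↦ (g, e)`. -/
structure IsCausalInverse {V W : Type*} [NormedAddCommGroup V] [NormedAddCommGroup W]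
    (G : (ℝ → W) → (ℝ → V)) (Δ : (ℝ → V) → (ℝ → W))
    (R : (ℝ → WithLp 2 (V × W)) → (ℝ → WithLp 2 (V × W))) : Prop where
  isCausal : IsCausalOperator R
  rightInv : ∀ h, IsL2e h → SigEq (loopMap G Δ (R h)) h
  leftInv : ∀ p, IsL2e p → SigEq (R (loopMap G Δ p)) p

/-- The feedback interconnection of the causal operators `G` and `Δ` is stable: it is
well-posed (the map `(v, w) ↦ (g, e)` has a causal inverse on `L₂ₑ`), and the inverse is bounded,
`∫₀ᵀ (|v|² + |w|²) ≤ c ∫₀ᵀ (|g|² + |e|²)` for all `T ≥ 0`, with one constant `c > 0`. -/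
def IsStableInterconnection {V W : Type*} [NormedAddCommGroup V] [NormedAddCommGroup W]
    (G : (ℝ → W) → (ℝ → V)) (Δ : (ℝ → V) → (ℝ → W)) : Prop :=
  IsCausalOperator G ∧ IsCausalOperator Δ ∧
    ∃ R, IsCausalInverse G Δ R ∧
      ∃ c : ℝ, 0 < c ∧ ∀ h, IsL2e h → ∀ T : ℝ, 0 ≤ T →
        ∫ t in (0 : ℝ)..T, ‖R h t‖ ^ 2 ≤ c * ∫ t in (0 : ℝ)..T, ‖h t‖ ^ 2

/-! ### Linear time-invariant systems -/

/-- The matrices of a linear system `ż = A z + B u`, `y = C z + D u`. -/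
structure LinearSystem (n m p : Type*) where
  A : Matrix n n ℝ
  B : Matrix n m ℝ
  C : Matrix p n ℝ
  D : Matrix p m ℝ

namespace LinearSystem

variable {n m p : Type*} [Fintype n] [DecidableEq n] [Fintype m] [DecidableEq m] [Fintype p]

/-- The transfer function matrix `G(s) = C (s I - A)⁻¹ B + D`. -/
def transferFunction (S : LinearSystem n m p) (s : ℂ) : Matrix p m ℂ :=
  S.C.map Complex.ofReal *
    (s • (1 : Matrix n n ℂ) - S.A.map Complex.ofReal)⁻¹ * S.B.map Complex.ofReal +
      S.D.map Complex.ofReal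

/-- The kernel `C exp(t A) B`, whose Laplace transform is `G(s) - D`. -/
def kernel (S : LinearSystem n m p) (t : ℝ) : Matrix p m ℝ :=
  S.C * NormedSpace.exp (t • S.A) * S.B

/-- The causal operator with transfer function `G(s)`, i.e. the input-output map of the system
from rest: `(G u)(t) = ∫₀ᵗ C exp((t - s) A) B u(s) ds + D u(t)`. -/
def operator (S : LinearSystem n m p) (u : ℝ → EuclideanSpace ℝ m) :
    ℝ → EuclideanSpace ℝ p := fun t =>
  (∫ s in (0 : ℝ)..t, Matrix.toEuclideanLin (S.kernel (t - s)) (u s)) +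
    Matrix.toEuclideanLin S.D (u t)

end LinearSystem

/-! ### The Lur'e system of continuous-time mirror descent -/

/-- The linear part, with `a = η μf μφ'`:
`A = -a I`, `B = [-η I, -η μf I]`, `C = [μφ' I; I]`, `D = [0, I; 0, 0]`.
Here `μφ'` is the strong convexity constant of the conjugate function. -/
def lureSystem (d : ℕ) (η μf μφ' : ℝ) :
    LinearSystem (Fin d) (Fin d ⊕ Fin d) (Fin d ⊕ Fin d) where
  A := (-(η * μf * μφ')) • 1
  B := Matrix.fromCols ((-η) • 1) ((-(η * μf)) • 1)
  C := Matrix.fromRows (μφ' • 1) 1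
  D := Matrix.fromBlocks 0 1 0 0

/-- The first block of a vector of `ℝᵈ × ℝᵈ`. -/
def block₁ {d : ℕ} (y : EuclideanSpace ℝ (Fin d ⊕ Fin d)) : EuclideanSpace ℝ (Fin d) :=
  WithLp.toLp 2 fun i => y (Sum.inl i)

/-- The second block of a vector of `ℝᵈ × ℝᵈ`. -/
def block₂ {d : ℕ} (y : EuclideanSpace ℝ (Fin d ⊕ Fin d)) : EuclideanSpace ℝ (Fin d) :=
  WithLp.toLp 2 fun i => y (Sum.inr i)

/-- The vector of `ℝᵈ × ℝᵈ` with given blocks. -/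
def stack {d : ℕ} (a b : EuclideanSpace ℝ (Fin d)) : EuclideanSpace ℝ (Fin d ⊕ Fin d) :=
  WithLp.toLp 2 (Sum.elim (fun i => a i) (fun i => b i))

/-- The shifted nonlinearity
`x ↦ (∇h (x + y₀) - μ (x + y₀)) - (∇h y₀ - μ y₀)`. -/
def shiftedGrad {d : ℕ} (h : EuclideanSpace ℝ (Fin d) → ℝ) (μ : ℝ)
    (y₀ x : EuclideanSpace ℝ (Fin d)) : EuclideanSpace ℝ (Fin d) :=
  (gradient h (x + y₀) - μ • (x + y₀)) - (gradient h y₀ - μ • y₀)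

/-- The static operator `Δ`: `(Δ v)(t) = (Δ₁ (v₁ t), Δ₂ (v₂ t))`, with `Δ₁` built from
`∇f - μf id` around `y₁` and `Δ₂` from `∇ψ - μψ id` around `y₂`. -/
def lureNonlinearity {d : ℕ} (f ψ : EuclideanSpace ℝ (Fin d) → ℝ) (μf μψ : ℝ)
    (y₁ y₂ : EuclideanSpace ℝ (Fin d)) (v : ℝ → EuclideanSpace ℝ (Fin d ⊕ Fin d)) :
    ℝ → EuclideanSpace ℝ (Fin d ⊕ Fin d) := fun t =>
  stack (shiftedGrad f μf y₁ (block₁ (v t))) (shiftedGrad ψ μψ y₂ (block₂ (v t)))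

/-- `z` solves continuous-time mirror descent `ż = -η ∇f(∇φ̄(z))` on `[0, ∞)`, `z(0) = z₀`. -/
structure IsTrajectory {d : ℕ} (f φ : EuclideanSpace ℝ (Fin d) → ℝ) (η : ℝ)
    (z₀ : EuclideanSpace ℝ (Fin d)) (z : ℝ → EuclideanSpace ℝ (Fin d)) : Prop where
  init : z 0 = z₀
  deriv : ∀ t : ℝ, 0 ≤ t →
    HasDerivWithinAt z (-η • gradient f (gradient (conjugate φ) (z t))) (Ici 0) t

/-! ### The transfer function of the linear part -/

theorem lureSystem_resolvent (d : ℕ) (η μf μφ' : ℝ) (s : ℂ)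
    (hs : s + (η * μf * μφ' : ℝ) ≠ 0) :
    (s • (1 : Matrix (Fin d) (Fin d) ℂ) - (lureSystem d η μf μφ').A.map Complex.ofReal)⁻¹ =
      (s + (η * μf * μφ' : ℝ))⁻¹ • 1 := by
  have h : s • (1 : Matrix (Fin d) (Fin d) ℂ) - (lureSystem d η μf μφ').A.map Complex.ofReal =
      (s + (η * μf * μφ' : ℝ)) • 1 := by
    ext i j
    by_cases hij : i = j <;> simp [lureSystem, hij]
  rw [h]
  apply Matrix.inv_eq_right_inv
  rw [Matrix.smul_mul, Matrix.one_mul, smul_smul, mul_inv_cancel₀ hs, one_smul]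

theorem lureSystem_C_mul_B (d : ℕ) (η μf μφ' : ℝ) :
    (lureSystem d η μf μφ').C * (lureSystem d η μf μφ').B = Matrix.fromBlocks
      ((-(η * μφ')) • 1) ((-(η * μf * μφ')) • 1) ((-η) • 1) ((-(η * μf)) • 1) := by
  simp only [lureSystem, Matrix.fromRows_mul_fromCols, Matrix.smul_mul, Matrix.one_mul,
    smul_smul]
  congr 2 <;> ring

theorem lureSystem_C_mul_B_map (d : ℕ) (η μf μφ' : ℝ) :
    (lureSystem d η μf μφ').C.map Complex.ofReal *
      (lureSystem d η μf μφ').B.map Complex.ofReal =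
      ((lureSystem d η μf μφ').C * (lureSystem d η μf μφ').B).map Complex.ofReal :=
  (Matrix.map_mul (f := Complex.ofRealHom)).symm

/-- `G(s) = (s + a)⁻¹ [[-η μφ', s], [-η, -η μf]] ⊗ I_d` with `a = η μf μφ'`. -/
theorem lureSystem_transferFunction (d : ℕ) (η μf μφ' : ℝ) (s : ℂ)
    (hs : s + (η * μf * μφ' : ℝ) ≠ 0) :
    (lureSystem d η μf μφ').transferFunction s =
      (s + (η * μf * μφ' : ℝ))⁻¹ • Matrix.fromBlocks
        ((-(η * μφ' : ℝ) : ℂ) • 1) (s • 1) ((-η : ℂ) • 1) ((-(η * μf : ℝ) : ℂ) • 1) := by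
  rw [LinearSystem.transferFunction, lureSystem_resolvent d η μf μφ' s hs, Matrix.mul_smul,
    Matrix.mul_one, Matrix.smul_mul, lureSystem_C_mul_B_map, lureSystem_C_mul_B]
  push_cast at hs
  ext i j
  rcases i with i | i <;> rcases j with j | j <;> by_cases hij : i = j <;>
    simp [lureSystem, hij]
  field_simp
  ring

/-- The matrix exponential of `t A`. -/
theorem lureSystem_exp (d : ℕ) (η μf μφ' t : ℝ) :
    NormedSpace.exp (t • (lureSystem d η μf μφ').A) =
      Real.exp (-(η * μf * μφ') * t) • (1 : Matrix (Fin d) (Fin d) ℝ) := by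
  have h1 : t • (lureSystem d η μf μφ').A =
      Matrix.diagonal (fun _ => -(η * μf * μφ') * t) := by
    ext i j
    by_cases hij : i = j
    · subst hij
      simp [lureSystem]
      ring
    · simp [lureSystem, hij]
  rw [h1, Matrix.exp_diagonal]
  ext i j
  by_cases hij : i = j
  · subst hij
    simp [Real.exp_eq_exp_ℝ, Pi.coe_exp]
  · simp [hij]

/-- The Laplace transform of the kernel is `G(s) - D`, so `operator` is the causal operator with
transfer function `G(s)`. -/
theorem lureSystem_laplace (d : ℕ) (η μf μφ' : ℝ) (s : ℂ)
    (hs : 0 < (s + (η * μf * μφ' : ℝ)).re) (i j : Fin d ⊕ Fin d) :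
    ∫ t in Ioi (0 : ℝ), Complex.exp (-s * t) * ((lureSystem d η μf μφ').kernel t i j : ℂ) =
      (lureSystem d η μf μφ').transferFunction s i j -
        ((lureSystem d η μf μφ').D i j : ℂ) := by
  have hs0 : s + (η * μf * μφ' : ℝ) ≠ 0 := by
    intro h
    rw [h] at hs
    exact lt_irrefl _ hs
  have hk : ∀ t : ℝ, Complex.exp (-s * t) * ((lureSystem d η μf μφ').kernel t i j : ℂ) =
      Complex.exp (-(s + (η * μf * μφ' : ℝ)) * t) *
        ((((lureSystem d η μf μφ').C * (lureSystem d η μf μφ').B) i j : ℝ) : ℂ) := by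
    intro t
    rw [LinearSystem.kernel, lureSystem_exp, Matrix.mul_smul, Matrix.mul_one, Matrix.smul_mul,
      Matrix.smul_apply, smul_eq_mul, Complex.ofReal_mul, Complex.ofReal_exp, ← mul_assoc,
      ← Complex.exp_add]
    congr 2
    push_cast
    ring
  simp_rw [hk]
  rw [integral_mul_const, integral_exp_mul_complex_Ioi (by rw [Complex.neg_re]; exact neg_neg_of_pos hs),
    LinearSystem.transferFunction, lureSystem_resolvent d η μf μφ' s hs0]
  rw [Matrix.mul_smul, Matrix.mul_one, Matrix.smul_mul, lureSystem_C_mul_B_map]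
  have hq : -Complex.exp (-(s + (η * μf * μφ' : ℝ)) * (0 : ℝ)) / -(s + (η * μf * μφ' : ℝ)) =
      (s + (η * μf * μφ' : ℝ))⁻¹ := by
    rw [Complex.ofReal_zero, mul_zero, Complex.exp_zero, neg_div_neg_eq, one_div]
  rw [hq, Matrix.add_apply, Matrix.smul_apply, Matrix.map_apply, Matrix.map_apply, smul_eq_mul,
    add_sub_cancel_right]

end MirrorDescent

end

open MirrorDescent

/-!
The closed loop has a single state `ξ`, the output of the first-order lag
`ξ̇ = -η μf μφ' ξ - η (w₁ + μf w₂)`, and the feedthrough of the linear part acts only from `w₂` to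
`v₁`. Given the state and the external signal `(g, e)`, the loop signals are therefore computed
one after the other in the order `v₂, w₂, v₁, w₁` (`loopSignals`), by a Lipschitz map. The loop
reduces to an integral equation for `ξ` with Lipschitz right-hand side, which has
exactly one solution on `[0, ∞)` (`exists_eq_lag`, `eqOn_Icc_of_eq_lag`), and whose solution on
`[0, T]` depends only on the external signal on `[0, T]`. This is well-posedness with a causal
inverse (`exists_isCausalInverse`).

Without external signals the terms `μf` and `μφ'` introduced by the loop transformation cancel and
`ξ = z - zopt` obeys mirror descent, `ξ̇ = -η ∇f(∇φ̄(ξ + zopt))` (`closedLoop_eq`). The Bregman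
divergence `V(ξ) = φ̄(ξ + zopt) - φ̄(zopt) - ⟨xopt, ξ⟩` has gradient
`P = ∇φ̄(ξ + zopt) - xopt`, so strong monotonicity of `∇f` gives
`V̇ = -η ⟨P, ∇f(P + xopt)⟩ ≤ -η μf ‖P‖²`, while `‖ξ‖ ≤ Lφ ‖P‖`. The external signals perturb the
right-hand side by at most a multiple of `‖(g, e)‖`, and Young's inequality yields
`V̇ ≤ -c ‖ξ‖² + K ‖(g, e)‖²` (`inner_closedLoop_le`). For signals in `L₂ₑ` the state is only
absolutely continuous; the integrated inequality still holds
(`AbsolutelyContinuousOnInterval.sub_le_integral_of_inner_le`), and `V ≥ 0`, `V(0) = 0` turn it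
into the gain bound, uniformly in `T` (`isStableInterconnection_of_dissipation`).

The same function proves convergence of mirror descent. Along a trajectory it is the Bregman
divergence of `φ` between `xopt` and `x(t) = ∇φ̄(z(t))`, hence comparable to `‖x(t) - xopt‖²`, so
the inequality `V̇ ≤ -η μf ‖x - xopt‖²` makes it decay exponentially
(`IsTrajectory.conjBregman_le`).

The facts on gradients used throughout are cocoercivity (`ClassS.cocoercive`), which makes `∇f`
and `∇φ` Lipschitz and bijective, and `∇φ̄ = (∇φ)⁻¹` (`ClassS.hasGradientAt_conjugate`).
-/

/-! ### Gradients of smooth strongly convex functions -/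

section ClassS

variable {E : Type*} [NormedAddCommGroup E] [InnerProductSpace ℝ E] [CompleteSpace E]

/-- A linear lower bound on the growth of the gradient along a segment integrates to a quadratic
lower bound on the Bregman divergence. -/
theorem half_le_bregman_of_le_inner {f : E → ℝ} {p : E → E}
    (hp : ∀ x, HasGradientAt f (p x) x) {x y : E} {c : ℝ}
    (hc : ∀ t ∈ Ioo (0 : ℝ) 1, c * t ≤ inner ℝ (p (x + t • (y - x)) - p x) (y - x)) :
    c / 2 ≤ f y - f x - inner ℝ (p x) (y - x) := by
  have hd : ∀ t : ℝ, HasDerivAt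
      (fun t : ℝ => f (x + t • (y - x)) - t * inner ℝ (p x) (y - x) - c / 2 * t ^ 2)
      (inner ℝ (p (x + t • (y - x)) - p x) (y - x) - c * t) t := by
    intro t
    have h1 : HasDerivAt (fun t : ℝ => x + t • (y - x)) (y - x) t := by
      simpa using ((hasDerivAt_id t).smul_const (y - x)).const_add x
    have h2 := (hp (x + t • (y - x))).hasFDerivAt.comp_hasDerivAt t h1
    have h3 := (h2.sub ((hasDerivAt_id t).mul_const (inner ℝ (p x) (y - x)))).sub
      (((hasDerivAt_id t).pow 2).const_mul (c / 2))
    refine HasDerivAt.congr_deriv (f' := _) h3 ?_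
    simp [inner_sub_left]
    ring
  have hm : MonotoneOn
      (fun t : ℝ => f (x + t • (y - x)) - t * inner ℝ (p x) (y - x) - c / 2 * t ^ 2)
      (Icc 0 1) := by
    refine monotoneOn_of_deriv_nonneg (convex_Icc 0 1)
      (fun t _ => (hd t).continuousAt.continuousWithinAt)
      (fun t _ => (hd t).differentiableAt.differentiableWithinAt) fun t ht => ?_
    rw [interior_Icc] at ht
    rw [(hd t).deriv]
    linarith [hc t ht]
  have h := hm (left_mem_Icc.2 zero_le_one) (right_mem_Icc.2 zero_le_one) zero_le_one
  simp only [zero_smul, one_smul, add_zero, add_sub_cancel] at h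
  linarith

namespace MirrorDescent.ClassS

variable {μ L : ℝ} {f : E → ℝ}

theorem hasGradientAt (hf : ClassS μ L f) (x : E) : HasGradientAt f (gradient f x) x :=
  (hf.contDiff.differentiable one_ne_zero x).hasGradientAt

theorem le_bregman (hf : ClassS μ L f) (x y : E) :
    μ / 2 * ‖y - x‖ ^ 2 ≤ f y - f x - inner ℝ (gradient f x) (y - x) := by
  have := half_le_bregman_of_le_inner hf.hasGradientAt (x := x) (y := y)
    (c := μ * ‖y - x‖ ^ 2) fun t ht => by
      have h := hf.lower (x + t • (y - x)) x
      rw [add_sub_cancel_left, norm_smul, inner_smul_right, Real.norm_of_nonneg ht.1.le] at h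
      refine le_of_mul_le_mul_left ?_ ht.1
      linarith
  linarith

theorem bregman_le (hf : ClassS μ L f) (x y : E) :
    f y - f x - inner ℝ (gradient f x) (y - x) ≤ L / 2 * ‖y - x‖ ^ 2 := by
  have := half_le_bregman_of_le_inner (f := fun x => -f x) (p := fun x => -gradient f x)
    (fun x => by
      rw [hasGradientAt_iff_hasFDerivAt, map_neg]
      exact (hf.hasGradientAt x).hasFDerivAt.neg) (x := x) (y := y)
    (c := -(L * ‖y - x‖ ^ 2)) fun t ht => by
      have h := hf.upper (x + t • (y - x)) x
      rw [add_sub_cancel_left, norm_smul, inner_smul_right, Real.norm_of_nonneg ht.1.le] at h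
      refine le_of_mul_le_mul_left ?_ ht.1
      rw [neg_sub_neg, ← neg_sub (gradient f (x + t • (y - x))), inner_neg_left]
      linarith
  rw [inner_neg_left] at this
  linarith

/-- Compare `f` at `y` with its value after a gradient step for the function
`f - ⟨∇f x, ·⟩`, whose minimum is attained at `x`. -/
theorem inv_two_mul_norm_sq_le_bregman (hμ : 0 ≤ μ) (hL : 0 < L) (hf : ClassS μ L f) (x y : E) :
    (2 * L)⁻¹ * ‖gradient f y - gradient f x‖ ^ 2 ≤
      f y - f x - inner ℝ (gradient f x) (y - x) := by
  set q := gradient f y - gradient f x with hq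
  have h1 := hf.le_bregman x (y - L⁻¹ • q)
  have h2 := hf.bregman_le y (y - L⁻¹ • q)
  have h3 : 0 ≤ μ / 2 * ‖y - L⁻¹ • q - x‖ ^ 2 := by positivity
  have e1 : y - L⁻¹ • q - x = (y - x) - L⁻¹ • q := by abel
  have e2 : y - L⁻¹ • q - y = -(L⁻¹ • q) := by abel
  rw [e1, inner_sub_right, inner_smul_right] at h1
  rw [e2, inner_neg_right, inner_smul_right, norm_neg, norm_smul, Real.norm_of_nonneg
    (inv_nonneg.2 hL.le)] at h2
  have e3 : inner ℝ (gradient f y) q - inner ℝ (gradient f x) q = ‖q‖ ^ 2 := by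
    rw [← inner_sub_left, ← hq, real_inner_self_eq_norm_sq]
  have e4 : L / 2 * (L⁻¹ * ‖q‖) ^ 2 = (2 * L)⁻¹ * ‖q‖ ^ 2 := by field_simp
  have e5 : L⁻¹ * ‖q‖ ^ 2 = 2 * ((2 * L)⁻¹ * ‖q‖ ^ 2) := by field_simp
  have e6 : L⁻¹ * inner ℝ (gradient f y) q - L⁻¹ * inner ℝ (gradient f x) q = L⁻¹ * ‖q‖ ^ 2 := by
    rw [← mul_sub, e3]
  rw [e1] at h3
  linarith

/-- The gradient of a convex function with upper curvature bound `L` is `L⁻¹`-cocoercive. -/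
theorem cocoercive (hμ : 0 ≤ μ) (hL : 0 < L) (hf : ClassS μ L f) (x y : E) :
    L⁻¹ * ‖gradient f x - gradient f y‖ ^ 2 ≤
      inner ℝ (gradient f x - gradient f y) (x - y) := by
  have h1 := hf.inv_two_mul_norm_sq_le_bregman hμ hL x y
  have h2 := hf.inv_two_mul_norm_sq_le_bregman hμ hL y x
  rw [norm_sub_rev] at h1
  have e5 : L⁻¹ * ‖gradient f x - gradient f y‖ ^ 2 =
    2 * ((2 * L)⁻¹ * ‖gradient f x - gradient f y‖ ^ 2) := by field_simp
  have e6 : inner ℝ (gradient f x) (y - x) = - inner ℝ (gradient f x) (x - y) := by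
    rw [← inner_neg_right, neg_sub]
  rw [inner_sub_left]
  linarith

theorem norm_gradient_sub_le (hμ : 0 ≤ μ) (hL : 0 < L) (hf : ClassS μ L f) (x y : E) :
    ‖gradient f x - gradient f y‖ ≤ L * ‖x - y‖ := by
  have h := (hf.cocoercive hμ hL x y).trans (real_inner_le_norm _ _)
  rcases (norm_nonneg (gradient f x - gradient f y)).eq_or_lt with h0 | h0
  · rw [← h0]; positivity
  · rw [inv_mul_le_iff₀ hL] at h
    refine le_of_mul_le_mul_left ?_ h0
    linarith

theorem mul_norm_sub_le_norm_gradient_sub (hf : ClassS μ L f) (x y : E) :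
    μ * ‖x - y‖ ≤ ‖gradient f x - gradient f y‖ := by
  have h := (hf.lower x y).trans (real_inner_le_norm _ _)
  rcases (norm_nonneg (x - y)).eq_or_lt with h0 | h0
  · rw [← h0]; simp
  · refine le_of_mul_le_mul_right ?_ h0
    linarith

theorem gradient_injective (hμ : 0 < μ) (hf : ClassS μ L f) :
    Function.Injective (gradient f) := by
  intro x y hxy
  have h := hf.mul_norm_sub_le_norm_gradient_sub x y
  rw [hxy, sub_self, norm_zero] at h
  rw [← sub_eq_zero, ← norm_le_zero_iff]
  exact nonpos_of_mul_nonpos_right h hμ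

/-- The gradient step `x ↦ x - L⁻¹ (∇f x - z)` is a contraction, and its fixed point is a
solution of `∇f x = z`. -/
theorem gradient_surjective (hμ : 0 < μ) (hμL : μ ≤ L) (hf : ClassS μ L f) :
    Function.Surjective (gradient f) := by
  intro z
  have hL : 0 < L := hμ.trans_le hμL
  -- Cocoercivity bounds the quadratic term of the squared step by half of the cross term, and strong
  -- monotonicity leaves the factor `1 - μ / L`.
  set K : NNReal := Real.toNNReal (Real.sqrt (1 - μ / L)) with hK
  have hk0 : 0 ≤ 1 - μ / L := sub_nonneg.2 ((div_le_one hL).2 hμL)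
  have hk : (K : ℝ) = Real.sqrt (1 - μ / L) := Real.coe_toNNReal _ (Real.sqrt_nonneg _)
  have hc : ContractingWith K (fun x => x - L⁻¹ • (gradient f x - z)) := by
    refine ⟨?_, LipschitzWith.of_dist_le_mul fun x y => ?_⟩
    · rw [← NNReal.coe_lt_coe, hk, NNReal.coe_one, Real.sqrt_lt' one_pos]
      have : 0 < μ / L := div_pos hμ hL
      linarith
    · rw [dist_eq_norm, dist_eq_norm, hk]
      refine abs_le_of_sq_le_sq' ?_ (by positivity) |>.2
      rw [mul_pow, Real.sq_sqrt hk0]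
      have e : x - L⁻¹ • (gradient f x - z) - (y - L⁻¹ • (gradient f y - z)) =
          (x - y) - L⁻¹ • (gradient f x - gradient f y) := by
        simp only [smul_sub]; abel
      rw [e, norm_sub_sq_real, inner_smul_right, norm_smul, Real.norm_of_nonneg
        (inv_nonneg.2 hL.le), real_inner_comm]
      have h1 := mul_le_mul_of_nonneg_left (hf.cocoercive hμ.le hL x y) (inv_nonneg.2 hL.le)
      have h2 := mul_le_mul_of_nonneg_left (hf.lower x y) (inv_nonneg.2 hL.le)
      have e2 : (1 - μ / L) * ‖x - y‖ ^ 2 = ‖x - y‖ ^ 2 - L⁻¹ * (μ * ‖x - y‖ ^ 2) := by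
        field_simp
      rw [e2]
      linarith
  obtain ⟨x, hx, -⟩ := hc.exists_fixedPoint 0 (edist_ne_top _ _)
  refine ⟨x, ?_⟩
  have hx' : x - L⁻¹ • (gradient f x - z) = x := hx
  rw [sub_eq_self, smul_eq_zero, sub_eq_zero] at hx'
  exact hx'.resolve_left (inv_ne_zero hL.ne')

theorem forall_le_iff_gradient_eq_zero (hμ : 0 ≤ μ) (hf : ClassS μ L f) (x : E) :
    (∀ y, f x ≤ f y) ↔ gradient f x = 0 := by
  constructor
  · intro h
    have h1 : IsLocalMin f x := Eventually.of_forall h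
    simp [gradient, h1.fderiv_eq_zero]
  · intro h y
    have h1 := hf.le_bregman x y
    have h2 : 0 ≤ μ / 2 * ‖y - x‖ ^ 2 := by positivity
    rw [h, inner_zero_left] at h1
    linarith

end MirrorDescent.ClassS

/-! ### The convex conjugate -/

namespace MirrorDescent.ClassS

variable {μ L : ℝ} {φ : E → ℝ}

/-- Equality in the Fenchel–Young inequality. -/
theorem conjugate_gradient (hμ : 0 ≤ μ) (hφ : ClassS μ L φ) (x : E) :
    conjugate φ (gradient φ x) = inner ℝ x (gradient φ x) - φ x := by
  have h : ∀ y, inner ℝ y (gradient φ x) - φ y ≤ inner ℝ x (gradient φ x) - φ x := by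
    intro y
    have h1 := hφ.le_bregman x y
    have h2 : 0 ≤ μ / 2 * ‖y - x‖ ^ 2 := by positivity
    rw [real_inner_comm, inner_sub_left] at h1
    linarith
  exact le_antisymm (ciSup_le h)
    (le_ciSup (f := fun y => inner ℝ y (gradient φ x) - φ y) ⟨_, forall_mem_range.2 h⟩ x)

/-- The Bregman divergence of the conjugate is the Bregman divergence of `φ` with the two points
exchanged. -/
theorem conjugate_bregman (hμ : 0 ≤ μ) (hφ : ClassS μ L φ) (x y : E) :
    conjugate φ (gradient φ y) - conjugate φ (gradient φ x) -
      inner ℝ x (gradient φ y - gradient φ x) = φ x - φ y - inner ℝ (gradient φ y) (x - y) := by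
  rw [hφ.conjugate_gradient hμ, hφ.conjugate_gradient hμ, inner_sub_right, inner_sub_right,
    real_inner_comm x (gradient φ y), real_inner_comm y (gradient φ y)]
  ring

theorem hasGradientAt_conjugate (hμ : 0 < μ) (hμL : μ ≤ L) (hφ : ClassS μ L φ) (x : E) :
    HasGradientAt (conjugate φ) x (gradient φ x) := by
  rw [hasGradientAt_iff_isLittleO]
  refine Asymptotics.IsBigO.trans_isLittleO (g := fun z => ‖z - gradient φ x‖ ^ 2)
    (Asymptotics.IsBigO.of_bound (L / 2 * (μ⁻¹) ^ 2) (Eventually.of_forall fun z => ?_)) ?_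
  · obtain ⟨y, rfl⟩ := hφ.gradient_surjective hμ hμL z
    rw [hφ.conjugate_bregman hμ.le]
    have h0 : 0 ≤ φ x - φ y - inner ℝ (gradient φ y) (x - y) :=
      le_trans (by positivity) (hφ.le_bregman y x)
    have hL : 0 < L := hμ.trans_le hμL
    have h2 : ‖x - y‖ ≤ μ⁻¹ * ‖gradient φ y - gradient φ x‖ := by
      rw [le_inv_mul_iff₀ hμ, norm_sub_rev (gradient φ y)]
      exact hφ.mul_norm_sub_le_norm_gradient_sub x y
    rw [Real.norm_of_nonneg h0, Real.norm_of_nonneg (by positivity)]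
    calc _ ≤ L / 2 * ‖x - y‖ ^ 2 := hφ.bregman_le y x
      _ ≤ L / 2 * (μ⁻¹ * ‖gradient φ y - gradient φ x‖) ^ 2 := by gcongr
      _ = _ := by ring
  · have h : Tendsto (fun z => z - gradient φ x) (𝓝 (gradient φ x)) (𝓝 0) := by
      exact tendsto_sub_nhds_zero_iff.2 tendsto_id
    exact (Asymptotics.isLittleO_norm_pow_id one_lt_two).comp_tendsto h

/-- The gradient of the conjugate inverts the gradient. -/
theorem gradient_conjugate_gradient (hμ : 0 < μ) (hμL : μ ≤ L) (hφ : ClassS μ L φ) (x : E) :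
    gradient (conjugate φ) (gradient φ x) = x :=
  (hφ.hasGradientAt_conjugate hμ hμL x).gradient

theorem gradient_gradient_conjugate (hμ : 0 < μ) (hμL : μ ≤ L) (hφ : ClassS μ L φ) (z : E) :
    gradient φ (gradient (conjugate φ) z) = z := by
  obtain ⟨x, rfl⟩ := hφ.gradient_surjective hμ hμL z
  rw [hφ.gradient_conjugate_gradient hμ hμL]

theorem norm_gradient_conjugate_sub_le (hμ : 0 < μ) (hμL : μ ≤ L) (hφ : ClassS μ L φ) (z w : E) :
    ‖gradient (conjugate φ) z - gradient (conjugate φ) w‖ ≤ μ⁻¹ * ‖z - w‖ := by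
  have h := hφ.mul_norm_sub_le_norm_gradient_sub
    (gradient (conjugate φ) z) (gradient (conjugate φ) w)
  rwa [hφ.gradient_gradient_conjugate hμ hμL, hφ.gradient_gradient_conjugate hμ hμL,
    ← le_inv_mul_iff₀ hμ] at h

theorem norm_sub_le_gradient_conjugate (hμ : 0 < μ) (hμL : μ ≤ L) (hφ : ClassS μ L φ) (z w : E) :
    ‖z - w‖ ≤ L * ‖gradient (conjugate φ) z - gradient (conjugate φ) w‖ := by
  have h := hφ.norm_gradient_sub_le hμ.le (hμ.trans_le hμL)
    (gradient (conjugate φ) z) (gradient (conjugate φ) w)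
  rwa [hφ.gradient_gradient_conjugate hμ hμL, hφ.gradient_gradient_conjugate hμ hμL] at h

end MirrorDescent.ClassS

end ClassS

/-! ### Integral equations with a Lipschitz right-hand side -/

section IntegralEquation

variable {E : Type*} [NormedAddCommGroup E] [NormedSpace ℝ E]

theorem integral_mul_exp_le {K t : ℝ} :
    ∫ s in (0 : ℝ)..t, K * Real.exp (2 * K * s) ≤ Real.exp (2 * K * t) / 2 := by
  have hd : ∀ s : ℝ, HasDerivAt (fun s => Real.exp (2 * K * s) / 2)
      (K * Real.exp (2 * K * s)) s := by
    intro s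
    have h := (((hasDerivAt_id s).const_mul (2 * K)).exp).div_const 2
    refine HasDerivAt.congr_deriv (f' := _) h ?_
    simp
    ring
  rw [intervalIntegral.integral_eq_sub_of_hasDerivAt (fun s _ => hd s)
    (Continuous.intervalIntegrable (by fun_prop) _ _)]
  have := Real.exp_pos (2 * K * 0)
  linarith

/-- The Picard operator is a contraction of `C([0, T], E)` after the change of unknown
`y t = exp (2 K t) • u t`. -/
theorem exists_integral_eq_Icc [CompleteSpace E] {M : ℝ → E → E} {K T : ℝ} (hK : 0 < K)
    (hT : 0 ≤ T) (hM : ∀ s x y, ‖M s x - M s y‖ ≤ K * ‖x - y‖)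
    (hint : ∀ y : ℝ → E, ContinuousOn y (Icc 0 T) →
      IntervalIntegrable (fun s => M s (y s)) volume 0 T) (y₀ : E) :
    ∃ y : ℝ → E, ContinuousOn y (Icc 0 T) ∧
      ∀ t ∈ Icc 0 T, y t = y₀ + ∫ s in (0 : ℝ)..t, M s (y s) := by
  let ext : C(Icc 0 T, E) → ℝ → E := fun u s => Real.exp (2 * K * s) • IccExtend hT u s
  have hext : ∀ u, Continuous (ext u) := fun u => by
    have := u.continuous.Icc_extend' (h := hT)
    exact Continuous.smul (by fun_prop) this
  have hextint : ∀ u, ∀ t ∈ Icc 0 T, IntervalIntegrable (fun s => M s (ext u s)) volume 0 t :=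
    fun u t ht => (hint _ (hext u).continuousOn).mono_set
      (by rw [uIcc_of_le ht.1, uIcc_of_le hT]; exact Icc_subset_Icc_right ht.2)
  have hcont : ∀ u, Continuous fun t : Icc 0 T =>
      Real.exp (-(2 * K * t)) • (y₀ + ∫ s in (0 : ℝ)..t, M s (ext u s)) := fun u => by
    have h1 := intervalIntegral.continuousOn_primitive_interval' (hint _ (hext u).continuousOn)
      left_mem_uIcc
    rw [uIcc_of_le hT] at h1
    have h2 : Continuous fun t : Icc 0 T => ∫ s in (0 : ℝ)..t, M s (ext u s) := h1.domRestrict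
    exact Continuous.smul (by fun_prop) (continuous_const.add h2)
  let Φ : C(Icc 0 T, E) → C(Icc 0 T, E) := fun u => ⟨_, hcont u⟩
  have hΦ : ContractingWith (1 / 2) Φ := by
    refine ⟨by rw [← NNReal.coe_lt_coe]; norm_num, LipschitzWith.of_dist_le_mul fun u v => ?_⟩
    rw [ContinuousMap.dist_le (by positivity)]
    intro t
    have hle : ∀ s, ‖M s (ext u s) - M s (ext v s)‖ ≤
        K * Real.exp (2 * K * s) * dist u v := fun s => by
      refine (hM _ _ _).trans ?_
      rw [mul_assoc, ← smul_sub, norm_smul, Real.norm_of_nonneg (Real.exp_pos _).le,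
        ← dist_eq_norm]
      gcongr
      exact ContinuousMap.dist_apply_le_dist _
    have hb : ‖(∫ s in (0 : ℝ)..t, M s (ext u s)) - ∫ s in (0 : ℝ)..t, M s (ext v s)‖ ≤
        Real.exp (2 * K * t) / 2 * dist u v := by
      rw [← intervalIntegral.integral_sub (hextint u t t.2) (hextint v t t.2)]
      refine (intervalIntegral.norm_integral_le_of_norm_le t.2.1
        (Eventually.of_forall fun s _ => hle s)
        (Continuous.intervalIntegrable (by fun_prop) _ _)).trans ?_
      rw [intervalIntegral.integral_mul_const]
      gcongr
      exact integral_mul_exp_le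
    change dist (Real.exp (-(2 * K * t)) • (y₀ + ∫ s in (0 : ℝ)..t, M s (ext u s)))
      (Real.exp (-(2 * K * t)) • (y₀ + ∫ s in (0 : ℝ)..t, M s (ext v s))) ≤ _
    rw [dist_smul₀, dist_add_left, dist_eq_norm, Real.norm_of_nonneg (Real.exp_pos _).le]
    calc _ ≤ Real.exp (-(2 * K * t)) * (Real.exp (2 * K * t) / 2 * dist u v) := by gcongr
      _ = Real.exp (-(2 * K * t)) * Real.exp (2 * K * t) * (1 / 2 * dist u v) := by ring
      _ = _ := by rw [← Real.exp_add, neg_add_cancel, Real.exp_zero]; simp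
  obtain ⟨u, hu, -⟩ := hΦ.exists_fixedPoint 0 (edist_ne_top _ _)
  refine ⟨ext u, (hext u).continuousOn, fun t ht => ?_⟩
  have h := DFunLike.congr_fun hu ⟨t, ht⟩
  have h' : Real.exp (-(2 * K * t)) • (y₀ + ∫ s in (0 : ℝ)..t, M s (ext u s)) = u ⟨t, ht⟩ := h
  simp only [ext] at h' ⊢
  rw [IccExtend_of_mem hT _ ht, ← h', smul_smul, ← Real.exp_add, add_neg_cancel, Real.exp_zero,
    one_smul]

theorem eqOn_Icc_of_integral_eq {M : ℝ → E → E} {K T : ℝ} (hT : 0 ≤ T)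
    (hM : ∀ s x y, ‖M s x - M s y‖ ≤ K * ‖x - y‖)
    (hint : ∀ y : ℝ → E, ContinuousOn y (Icc 0 T) →
      IntervalIntegrable (fun s => M s (y s)) volume 0 T) {y₀ : E} {y y' : ℝ → E}
    (hy : ContinuousOn y (Icc 0 T)) (hy' : ContinuousOn y' (Icc 0 T))
    (he : ∀ t ∈ Icc 0 T, y t = y₀ + ∫ s in (0 : ℝ)..t, M s (y s))
    (he' : ∀ t ∈ Icc 0 T, y' t = y₀ + ∫ s in (0 : ℝ)..t, M s (y' s)) :
    EqOn y y' (Icc 0 T) := by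
  -- The distance `u` of the two solutions, extended by constants outside `[0, T]`, satisfies
  -- `u ≤ K ∫ u`, so Grönwall's inequality applies to its primitive.
  set u : ℝ → ℝ := fun t => ‖y (projIcc 0 T hT t) - y' (projIcc 0 T hT t)‖ with hu
  have huc : Continuous u :=
    ((hy.comp_continuous continuous_projIcc.subtype_val fun t => (projIcc 0 T hT t).2).sub
      (hy'.comp_continuous continuous_projIcc.subtype_val fun t => (projIcc 0 T hT t).2)).norm
  have hut : ∀ t ∈ Icc 0 T, u t = ‖y t - y' t‖ := fun t ht => by
    simp only [hu, projIcc_of_mem hT ht]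
  have hle : ∀ t ∈ Icc 0 T, u t ≤ K * ∫ s in (0 : ℝ)..t, u s := fun t ht => by
    have hsub : uIcc 0 t ⊆ uIcc 0 T := by
      rw [uIcc_of_le ht.1, uIcc_of_le hT]; exact Icc_subset_Icc_right ht.2
    rw [hut t ht, he t ht, he' t ht, add_sub_add_left_eq_sub, ← intervalIntegral.integral_sub
      ((hint y hy).mono_set hsub) ((hint y' hy').mono_set hsub),
      ← intervalIntegral.integral_const_mul]
    refine intervalIntegral.norm_integral_le_of_norm_le ht.1
      (Eventually.of_forall fun s hs => ?_) ((huc.const_mul K).intervalIntegrable _ _)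
    rw [hut s ⟨hs.1.le, hs.2.trans ht.2⟩]
    exact hM _ _ _
  have hd : ∀ t, HasDerivAt (fun t => ∫ s in (0 : ℝ)..t, u s) (u t) t := fun t =>
    intervalIntegral.integral_hasDerivAt_right (huc.intervalIntegrable _ _)
      (huc.stronglyMeasurableAtFilter _ _) huc.continuousAt
  have h0 := eq_zero_of_abs_deriv_le_mul_abs_self_of_eq_zero_right (K := |K|) (a := 0) (b := T)
    (fun t _ => (hd t).continuousAt.continuousWithinAt) (fun t _ => (hd t).hasDerivWithinAt)
    intervalIntegral.integral_same (fun t ht => by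
      rw [Real.norm_of_nonneg (norm_nonneg _), Real.norm_eq_abs, ← abs_mul]
      exact (hle t ⟨ht.1, ht.2.le⟩).trans (le_abs_self _))
  intro t ht
  have h1 := hle t ht
  rw [h0 t ht, mul_zero, hut t ht] at h1
  rwa [← sub_eq_zero, ← norm_le_zero_iff]

/-- A solution on `[0, ∞)` is obtained by evaluating the solution on `[0, t]` at time `t`. -/
theorem exists_integral_eq_Ici [CompleteSpace E] {M : ℝ → E → E} {K : ℝ} (hK : 0 < K)
    (hM : ∀ s x y, ‖M s x - M s y‖ ≤ K * ‖x - y‖)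
    (hint : ∀ T, 0 ≤ T → ∀ y : ℝ → E, ContinuousOn y (Icc 0 T) →
      IntervalIntegrable (fun s => M s (y s)) volume 0 T) (y₀ : E) :
    ∃ y : ℝ → E, ContinuousOn y (Ici 0) ∧
      ∀ t, 0 ≤ t → y t = y₀ + ∫ s in (0 : ℝ)..t, M s (y s) := by
  choose! Y hYc hY using fun T (hT : 0 ≤ T) =>
    exists_integral_eq_Icc hK hT hM (hint T hT) y₀
  have hYY : ∀ T, 0 ≤ T → ∀ t ∈ Icc 0 T, Y t t = Y T t := fun T hT t ht =>
    eqOn_Icc_of_integral_eq ht.1 hM (hint t ht.1) (hYc t ht.1)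
      ((hYc T hT).mono (Icc_subset_Icc_right ht.2)) (hY t ht.1)
      (fun s hs => hY T hT s ⟨hs.1, hs.2.trans ht.2⟩) (right_mem_Icc.2 ht.1)
  refine ⟨fun t => Y t t, fun t ht => ?_, fun t ht => ?_⟩
  · have ht0 : (0 : ℝ) ≤ t := ht
    have h1 : ContinuousWithinAt (Y (t + 1)) (Icc 0 (t + 1)) t :=
      hYc (t + 1) (by linarith) t ⟨ht0, by linarith⟩
    have h2 := h1.congr (fun s hs => hYY (t + 1) (by linarith) s hs)
      (hYY (t + 1) (by linarith) t ⟨ht0, by linarith⟩)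
    refine h2.mono_of_mem_nhdsWithin ?_
    rw [← Ici_inter_Iic]
    exact inter_mem self_mem_nhdsWithin (mem_nhdsWithin_of_mem_nhds (Iic_mem_nhds (by linarith)))
  · refine (hY t ht t (right_mem_Icc.2 ht)).trans ?_
    congr 1
    refine intervalIntegral.integral_congr fun s hs => ?_
    rw [uIcc_of_le ht] at hs
    simp only [hYY t ht s hs]

end IntegralEquation

/-! ### The chain rule along absolutely continuous curves -/

section ChainRule

theorem AbsolutelyContinuousOnInterval.of_dist_le {X Y : Type*} [PseudoMetricSpace X]
    [PseudoMetricSpace Y] {f : ℝ → X} {g : ℝ → Y} {a b C : ℝ}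
    (hg : AbsolutelyContinuousOnInterval g a b)
    (h : ∀ x ∈ uIcc a b, ∀ y ∈ uIcc a b, dist (f x) (f y) ≤ C * dist (g x) (g y)) :
    AbsolutelyContinuousOnInterval f a b := by
  have h0 := Tendsto.const_mul C hg
  rw [mul_zero] at h0
  refine squeeze_zero' (Eventually.of_forall fun I => Finset.sum_nonneg fun _ _ => dist_nonneg)
    ?_ h0
  filter_upwards [mem_inf_of_right (mem_principal_self _)] with I hI
  rw [Finset.mul_sum]
  exact Finset.sum_le_sum fun i hi => h _ (hI.1 i hi).1 _ (hI.1 i hi).2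

theorem IntervalIntegrable.absolutelyContinuousOnInterval_primitive {E : Type*}
    [NormedAddCommGroup E] [NormedSpace ℝ E] {q : ℝ → E} {a b : ℝ}
    (hq : IntervalIntegrable q volume a b) :
    AbsolutelyContinuousOnInterval (fun t => ∫ s in a..t, q s) a b := by
  have hi : ∀ x ∈ uIcc a b, IntervalIntegrable q volume a x := fun x hx =>
    hq.mono_set (uIcc_subset_uIcc left_mem_uIcc hx)
  refine (hq.norm.absolutelyContinuousOnInterval_intervalIntegral left_mem_uIcc).of_dist_le
    (C := 1) fun x hx y hy => ?_
  rw [dist_eq_norm, Real.dist_eq, one_mul, intervalIntegral.integral_interval_sub_left (hi x hx)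
    (hi y hy), intervalIntegral.integral_interval_sub_left (hi x hx).norm (hi y hy).norm]
  exact intervalIntegral.norm_integral_le_abs_integral_norm

variable {E : Type*} [NormedAddCommGroup E] [InnerProductSpace ℝ E]

/-- Along an absolutely continuous curve a convex function with continuous gradient `p` is
absolutely continuous, because `p` is bounded on the compact image of the curve. -/
theorem AbsolutelyContinuousOnInterval.convex_comp {V : E → ℝ} {p : E → E} (hp : Continuous p)
    (hV : ∀ x y, inner ℝ (p x) (y - x) ≤ V y - V x) {ξ : ℝ → E} {a b : ℝ}
    (hξ : AbsolutelyContinuousOnInterval ξ a b) :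
    AbsolutelyContinuousOnInterval (fun t => V (ξ t)) a b := by
  obtain ⟨C, hC⟩ := isCompact_uIcc.exists_bound_of_continuousOn (hp.comp_continuousOn hξ.continuousOn)
  have key : ∀ x ∈ uIcc a b, ∀ y, V (ξ x) - V (ξ y) ≤ C * ‖ξ x - ξ y‖ := fun x hx y => by
    have h1 := hV (ξ x) (ξ y)
    have h2 : inner ℝ (p (ξ x)) (ξ x - ξ y) ≤ C * ‖ξ x - ξ y‖ :=
      (real_inner_le_norm _ _).trans (mul_le_mul_of_nonneg_right (hC x hx) (norm_nonneg _))
    rw [← neg_sub (ξ x), inner_neg_right] at h1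
    linarith
  refine hξ.of_dist_le (C := C) fun x hx y hy => ?_
  rw [Real.dist_eq, dist_eq_norm, abs_le]
  have h1 := key x hx y
  have h2 := key y hy x
  rw [norm_sub_rev] at h2
  constructor <;> linarith

/-- The integrated energy inequality: along an absolutely continuous curve, an almost everywhere
bound on the derivative of a convex function `V` bounds the increment of `V`. -/
theorem AbsolutelyContinuousOnInterval.sub_le_integral_of_inner_le [CompleteSpace E]
    {V : E → ℝ} {p : E → E}
    (hp : Continuous p) (hVp : ∀ x, HasGradientAt V (p x) x)
    (hV : ∀ x y, inner ℝ (p x) (y - x) ≤ V y - V x) {ξ ξ' : ℝ → E} {T : ℝ} (hT : 0 ≤ T)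
    (hξ : AbsolutelyContinuousOnInterval ξ 0 T)
    (hξ' : ∀ᵐ t, t ∈ uIcc 0 T → HasDerivAt ξ (ξ' t) t) {r : ℝ → ℝ}
    (hr : IntervalIntegrable r volume 0 T)
    (hle : ∀ t ∈ Icc 0 T, inner ℝ (p (ξ t)) (ξ' t) ≤ r t) :
    V (ξ T) - V (ξ 0) ≤ ∫ t in (0 : ℝ)..T, r t := by
  have hac := hξ.convex_comp hp hV
  rw [← hac.integral_deriv_eq_sub]
  refine intervalIntegral.integral_mono_ae_restrict hT hac.intervalIntegrable_deriv hr ?_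
  rw [EventuallyLE, ae_restrict_iff' measurableSet_Icc]
  filter_upwards [hξ'] with t ht htT
  have h := (hVp (ξ t)).hasFDerivAt.comp_hasDerivAt t (ht (by rwa [uIcc_of_le hT]))
  have h' : deriv (fun t => V (ξ t)) t = inner ℝ (p (ξ t)) (ξ' t) := h.deriv
  rw [h']
  exact hle t htT

end ChainRule

/-! ### Signals in the extended space -/

section Signals

variable {E F : Type*} [NormedAddCommGroup E] [NormedAddCommGroup F]

theorem ContinuousOn.memLp_two_Icc {f : ℝ → E} {a b : ℝ} (hf : ContinuousOn f (Icc a b)) :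
    MemLp f 2 (volume.restrict (Icc a b)) := by
  obtain ⟨C, hC⟩ := isCompact_Icc.exists_bound_of_continuousOn hf
  exact MemLp.of_bound (hf.aestronglyMeasurable_of_isCompact isCompact_Icc measurableSet_Icc) C
    ((ae_restrict_mem measurableSet_Icc).mono hC)

theorem MeasureTheory.MemLp.pair {f : ℝ → E} {g : ℝ → F} {μ : Measure ℝ}
    (hf : MemLp f 2 μ) (hg : MemLp g 2 μ) : MemLp (fun t => (f t, g t)) 2 μ := by
  refine MemLp.of_le (hf.norm.add hg.norm)
    (hf.aestronglyMeasurable.prodMk hg.aestronglyMeasurable) (Eventually.of_forall fun t => ?_)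
  rw [Pi.add_apply, Real.norm_of_nonneg (by positivity)]
  exact max_le_add_of_nonneg (norm_nonneg _) (norm_nonneg _)

namespace MirrorDescent.IsL2e

theorem add {f g : ℝ → E} (hf : IsL2e f) (hg : IsL2e g) : IsL2e (fun t => f t + g t) :=
  fun T => (hf T).add (hg T)

theorem sub {f g : ℝ → E} (hf : IsL2e f) (hg : IsL2e g) : IsL2e (fun t => f t - g t) :=
  fun T => (hf T).sub (hg T)

theorem prodMk {f : ℝ → E} {g : ℝ → F} (hf : IsL2e f) (hg : IsL2e g) :
    IsL2e (fun t => (f t, g t)) :=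
  fun T => (hf T).pair (hg T)

theorem comp_lipschitz {D : E → F} {K : NNReal} (hD : LipschitzWith K D) (h0 : D 0 = 0)
    {f : ℝ → E} (hf : IsL2e f) : IsL2e (fun t => D (f t)) :=
  fun T => hD.comp_memLp h0 (hf T)

theorem of_continuousOn {f : ℝ → E} (hf : ContinuousOn f (Ici 0)) : IsL2e f := fun _ =>
  (hf.mono Icc_subset_Ici_self).memLp_two_Icc

theorem congr_on {f g : ℝ → E} (hf : IsL2e f) (h : ∀ t, 0 ≤ t → f t = g t) : IsL2e g :=
  fun T => (hf T).ae_eq ((ae_restrict_mem measurableSet_Icc).mono fun t ht => h t ht.1)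

theorem intervalIntegrable {f : ℝ → E} (hf : IsL2e f) {T : ℝ} (hT : 0 ≤ T) :
    IntervalIntegrable f volume 0 T := by
  rw [intervalIntegrable_iff_integrableOn_Icc_of_le hT]
  exact (hf T).integrable one_le_two

theorem intervalIntegrable_norm_sq {f : ℝ → E} (hf : IsL2e f) {T : ℝ} (hT : 0 ≤ T) :
    IntervalIntegrable (fun t => ‖f t‖ ^ 2) volume 0 T := by
  rw [intervalIntegrable_iff_integrableOn_Icc_of_le hT]
  exact (hf T).integrable_norm_pow two_ne_zero

end MirrorDescent.IsL2e

/-- An operator on `L₂ₑ` whose output on `[0, T]` depends only on the input on `[0, T]` is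
causal. -/
theorem MirrorDescent.IsCausalOperator.of_forall_ae_eq {H : (ℝ → E) → (ℝ → F)}
    (hmaps : ∀ f, IsL2e f → IsL2e (H f))
    (hloc : ∀ f g, IsL2e f → IsL2e g → ∀ T, 0 ≤ T → f =ᵐ[volume.restrict (Icc 0 T)] g →
      H f =ᵐ[volume.restrict (Icc 0 T)] H g) : IsCausalOperator H where
  mapsTo := hmaps
  congr f g hf hg hfg := by
    have h : Ici (0 : ℝ) = ⋃ n : ℕ, Icc (0 : ℝ) n := by
      ext t
      simp only [mem_Ici, mem_iUnion, mem_Icc, exists_and_left, iff_self_and]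
      exact fun _ => exists_nat_ge t
    rw [SigEq, h, EventuallyEq, ae_restrict_iUnion_iff]
    exact fun n => hloc f g hf hg n n.cast_nonneg (ae_restrict_of_ae_restrict_of_subset
      Icc_subset_Ici_self hfg)
  causal f hf T hT := by
    have h1 : IsL2e (trunc T f) := fun S => (hf S).indicator measurableSet_Iic
    have h2 := hloc (trunc T f) f h1 hf T hT ((ae_restrict_mem measurableSet_Icc).mono fun t ht =>
      indicator_of_mem (mem_Iic.2 ht.2) f)
    rw [EventuallyEq, ae_restrict_iff' measurableSet_Icc] at h2
    rw [SigEq, EventuallyEq, ae_restrict_iff' measurableSet_Ici]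
    filter_upwards [h2] with t ht ht0
    by_cases htT : t ≤ T
    · simp only [trunc, indicator_of_mem (mem_Iic.2 htT)] at ht ⊢
      exact ht ⟨ht0, htT⟩
    · simp only [trunc, indicator_of_notMem (mt mem_Iic.1 htT)]

/-- A static operator with Lipschitz characteristic vanishing at the origin is causal on `L₂ₑ`. -/
theorem MirrorDescent.IsCausalOperator.of_lipschitz {D : E → F} {K : NNReal}
    (hD : LipschitzWith K D) (h0 : D 0 = 0) :
    IsCausalOperator (fun (v : ℝ → E) t => D (v t)) :=
  .of_forall_ae_eq (fun _ hf => hf.comp_lipschitz hD h0)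
    fun _ _ _ _ _ _ h => h.mono fun _ ht => congrArg D ht

end Signals

/-! ### The first-order lag -/

section Lag

variable {E : Type*} [NormedAddCommGroup E] [NormedSpace ℝ E]

/-- The response from rest of the first-order lag `ξ̇ = -a ξ + q`, given by the variation of
constants formula `ξ(t) = ∫₀ᵗ exp(-a (t - s)) q(s) ds`. -/
noncomputable def lag (a : ℝ) (q : ℝ → E) (t : ℝ) : E :=
  ∫ s in (0 : ℝ)..t, Real.exp (-a * (t - s)) • q s

theorem lag_eq_smul (a : ℝ) (q : ℝ → E) (t : ℝ) :
    lag a q t = Real.exp (-a * t) • ∫ s in (0 : ℝ)..t, Real.exp (a * s) • q s := by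
  rw [lag, ← intervalIntegral.integral_smul]
  congr 1
  ext s
  rw [smul_smul, ← Real.exp_add]
  congr 2
  ring

theorem exp_smul_lag (a : ℝ) (q : ℝ → E) (t : ℝ) :
    Real.exp (a * t) • lag a q t = ∫ s in (0 : ℝ)..t, Real.exp (a * s) • q s := by
  rw [lag_eq_smul, smul_smul, ← Real.exp_add, neg_mul, add_neg_cancel, Real.exp_zero, one_smul]

theorem lag_zero (a : ℝ) (q : ℝ → E) : lag a q 0 = 0 := intervalIntegral.integral_same

theorem lag_congr {a T : ℝ} {q r : ℝ → E} (h : q =ᵐ[volume.restrict (Icc 0 T)] r) {t : ℝ}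
    (ht : t ∈ Icc 0 T) : lag a q t = lag a r t := by
  rw [EventuallyEq, ae_restrict_iff' measurableSet_Icc] at h
  refine intervalIntegral.integral_congr_ae ?_
  filter_upwards [h] with s hs hst
  rw [uIoc_of_le ht.1] at hst
  rw [hs ⟨hst.1.le, hst.2.trans ht.2⟩]

theorem intervalIntegrable_exp_smul (a : ℝ) {q : ℝ → E} {T : ℝ}
    (hq : IntervalIntegrable q volume 0 T) :
    IntervalIntegrable (fun s => Real.exp (a * s) • q s) volume 0 T :=
  hq.continuousOn_smul (by fun_prop)

theorem absolutelyContinuousOnInterval_lag (a : ℝ) {q : ℝ → E} {T : ℝ}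
    (hq : IntervalIntegrable q volume 0 T) : AbsolutelyContinuousOnInterval (lag a q) 0 T := by
  have h1 : AbsolutelyContinuousOnInterval (fun t : ℝ => Real.exp (-a * t)) 0 T :=
    ContDiffOn.absolutelyContinuousOnInterval (by fun_prop)
  rw [funext (lag_eq_smul a q)]
  exact h1.smul (intervalIntegrable_exp_smul a hq).absolutelyContinuousOnInterval_primitive

theorem ae_hasDerivAt_lag [CompleteSpace E] (a : ℝ) {q : ℝ → E} {T : ℝ}
    (hq : IntervalIntegrable q volume 0 T) :
    ∀ᵐ t, t ∈ uIcc 0 T → HasDerivAt (lag a q) (-a • lag a q t + q t) t := by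
  filter_upwards [(intervalIntegrable_exp_smul a hq).ae_hasDerivAt_integral] with t ht htT
  have h1 : HasDerivAt (fun t : ℝ => Real.exp (-a * t)) (Real.exp (-a * t) * -a) t := by
    simpa using ((hasDerivAt_id t).const_mul (-a)).exp
  have h2 := h1.smul (ht htT 0 left_mem_uIcc)
  have h3 : lag a q = fun t => Real.exp (-a * t) • ∫ s in (0 : ℝ)..t, Real.exp (a * s) • q s :=
    funext (lag_eq_smul a q)
  rw [h3]
  refine HasDerivAt.congr_deriv (f' := _) h2 ?_
  rw [smul_smul, smul_smul, ← Real.exp_add, neg_mul, neg_add_cancel, Real.exp_zero, one_smul,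
    add_comm, mul_comm (-a)]

theorem continuousOn_lag (a : ℝ) {q : ℝ → E}
    (hq : ∀ T, 0 ≤ T → IntervalIntegrable q volume 0 T) : ContinuousOn (lag a q) (Ici 0) := by
  intro t ht
  have ht0 : (0 : ℝ) ≤ t := ht
  have h := (absolutelyContinuousOnInterval_lag a (hq (t + 1) (by linarith))).continuousOn
  rw [uIcc_of_le (by linarith)] at h
  refine (h t ⟨ht0, by linarith⟩).mono_of_mem_nhdsWithin ?_
  rw [← Ici_inter_Iic]
  exact inter_mem self_mem_nhdsWithin (mem_nhdsWithin_of_mem_nhds (Iic_mem_nhds (by linarith)))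

variable {H : Type*} [NormedAddCommGroup H]

/-- In the unknown `y t = exp (a t) • ξ t`, the equation `ξ = lag a (N(ξ, h))` is an integral
equation with right-hand side `exp (a s) • N(exp (-a s) • y, h s)`. This right-hand side is
Lipschitz in `y` with the constant of `N`, increased by one to be positive even when `N` is
constant. -/
theorem norm_exp_smul_sub_le {N : E × H → E} {K : NNReal} (hN : LipschitzWith K N) (a : ℝ)
    (h : ℝ → H) (s : ℝ) (x y : E) :
    ‖Real.exp (a * s) • N (Real.exp (-a * s) • x, h s) -
      Real.exp (a * s) • N (Real.exp (-a * s) • y, h s)‖ ≤ (K + 1) * ‖x - y‖ := by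
  have h1 := hN.dist_le_mul (Real.exp (-a * s) • x, h s) (Real.exp (-a * s) • y, h s)
  rw [Prod.dist_eq, dist_self, max_eq_left dist_nonneg, dist_smul₀,
    Real.norm_of_nonneg (Real.exp_pos _).le, dist_eq_norm, dist_eq_norm] at h1
  rw [← smul_sub, norm_smul, Real.norm_of_nonneg (Real.exp_pos _).le]
  calc _ ≤ Real.exp (a * s) * (K * (Real.exp (-a * s) * ‖x - y‖)) := by gcongr
    _ = Real.exp (a * s) * Real.exp (-a * s) * (K * ‖x - y‖) := by ring
    _ = K * ‖x - y‖ := by rw [← Real.exp_add, neg_mul, add_neg_cancel, Real.exp_zero, one_mul]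
    _ ≤ _ := by gcongr; linarith

theorem intervalIntegrable_exp_smul_comp {N : E × H → E} {K : NNReal} (hN : LipschitzWith K N)
    (hN0 : N 0 = 0) (a : ℝ) {h : ℝ → H} (hh : IsL2e h) {T : ℝ} (hT : 0 ≤ T) {y : ℝ → E}
    (hy : ContinuousOn y (Icc 0 T)) :
    IntervalIntegrable (fun s => Real.exp (a * s) • N (Real.exp (-a * s) • y s, h s))
      volume 0 T := by
  refine intervalIntegrable_exp_smul a ?_
  rw [intervalIntegrable_iff_integrableOn_Icc_of_le hT]
  have h1 : ContinuousOn (fun s => Real.exp (-a * s) • y s) (Icc 0 T) :=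
    ContinuousOn.smul (by fun_prop) hy
  exact (hN.comp_memLp hN0 (h1.memLp_two_Icc.pair (hh T))).integrable one_le_two

/-- A lag in feedback with a Lipschitz characteristic has a response to every `L₂ₑ` signal. -/
theorem exists_eq_lag [CompleteSpace E] {N : E × H → E} {K : NNReal} (hN : LipschitzWith K N)
    (hN0 : N 0 = 0) (a : ℝ) {h : ℝ → H} (hh : IsL2e h) :
    ∃ ξ : ℝ → E, ContinuousOn ξ (Ici 0) ∧
      ∀ t, 0 ≤ t → ξ t = lag a (fun s => N (ξ s, h s)) t := by
  obtain ⟨y, hyc, hy⟩ := exists_integral_eq_Ici (K := K + 1) (by positivity)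
    (norm_exp_smul_sub_le hN a h)
    (fun T hT y hy => intervalIntegrable_exp_smul_comp hN hN0 a hh hT hy) 0
  refine ⟨fun t => Real.exp (-a * t) • y t, ContinuousOn.smul (by fun_prop) hyc, fun t ht => ?_⟩
  simp only [lag_eq_smul]
  rw [hy t ht, zero_add]

/-- On `[0, T]` the response depends only on the external signal on `[0, T]`. -/
theorem eqOn_Icc_of_eq_lag {N : E × H → E} {K : NNReal} (hN : LipschitzWith K N)
    (hN0 : N 0 = 0) {a T : ℝ} (hT : 0 ≤ T) {h h' : ℝ → H} (hh : IsL2e h)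
    (hhh : h =ᵐ[volume.restrict (Icc 0 T)] h') {ξ ξ' : ℝ → E}
    (hξc : ContinuousOn ξ (Icc 0 T)) (hξc' : ContinuousOn ξ' (Icc 0 T))
    (hξ : ∀ t ∈ Icc 0 T, ξ t = lag a (fun s => N (ξ s, h s)) t)
    (hξ' : ∀ t ∈ Icc 0 T, ξ' t = lag a (fun s => N (ξ' s, h' s)) t) : EqOn ξ ξ' (Icc 0 T) := by
  have hξ'' : ∀ t ∈ Icc 0 T, ξ' t = lag a (fun s => N (ξ' s, h s)) t := fun t ht =>
    (hξ' t ht).trans (lag_congr (hhh.mono fun s hs => by simp only [hs]) ht)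
  have key : ∀ ζ : ℝ → E, (∀ t ∈ Icc 0 T, ζ t = lag a (fun s => N (ζ s, h s)) t) →
      ∀ t ∈ Icc 0 T, Real.exp (a * t) • ζ t =
        0 + ∫ s in (0 : ℝ)..t,
          Real.exp (a * s) • N (Real.exp (-a * s) • (Real.exp (a * s) • ζ s), h s) := by
    intro ζ hζ t ht
    have hs : ∀ s : ℝ, Real.exp (-a * s) • (Real.exp (a * s) • ζ s) = ζ s := fun s => by
      rw [smul_smul, ← Real.exp_add, neg_mul, neg_add_cancel, Real.exp_zero, one_smul]
    simp only [hs, zero_add]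
    rw [← exp_smul_lag, ← hζ t ht]
  have h := eqOn_Icc_of_integral_eq hT (norm_exp_smul_sub_le hN a h)
    (fun y hy => intervalIntegrable_exp_smul_comp hN hN0 a hh hT hy)
    (y := fun t => Real.exp (a * t) • ξ t) (y' := fun t => Real.exp (a * t) • ξ' t)
    (ContinuousOn.smul (by fun_prop) hξc) (ContinuousOn.smul (by fun_prop) hξc')
    (key ξ hξ) (key ξ' hξ'')
  exact fun t ht => smul_right_injective E (Real.exp_pos (a * t)).ne' (h ht)

end Lag

/-! ### The linear part in block form -/

namespace MirrorDescent

variable {d : ℕ}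

section Blocks

variable (x y : EuclideanSpace ℝ (Fin d ⊕ Fin d)) (a b a' b' : EuclideanSpace ℝ (Fin d))

@[simp] theorem block₁_stack : block₁ (stack a b) = a := rfl

@[simp] theorem block₂_stack : block₂ (stack a b) = b := rfl

@[simp] theorem stack_block : stack (block₁ x) (block₂ x) = x := by
  ext i
  rcases i with i | i <;> rfl

@[simp] theorem block₁_sub : block₁ (x - y) = block₁ x - block₁ y := rfl

@[simp] theorem block₂_sub : block₂ (x - y) = block₂ x - block₂ y := rfl

@[simp] theorem stack_zero : stack (0 : EuclideanSpace ℝ (Fin d)) 0 = 0 := by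
  ext i
  rcases i with i | i <;> rfl

@[simp] theorem block₁_zero : block₁ (0 : EuclideanSpace ℝ (Fin d ⊕ Fin d)) = 0 := rfl

@[simp] theorem block₂_zero : block₂ (0 : EuclideanSpace ℝ (Fin d ⊕ Fin d)) = 0 := rfl

theorem norm_stack_sq : ‖stack a b‖ ^ 2 = ‖a‖ ^ 2 + ‖b‖ ^ 2 := by
  simp [EuclideanSpace.norm_sq_eq, stack]

theorem norm_block₁_le : ‖block₁ x‖ ≤ ‖x‖ := by
  have h := norm_stack_sq (block₁ x) (block₂ x)
  rw [stack_block] at h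
  exact (sq_le_sq₀ (norm_nonneg _) (norm_nonneg _)).1 (by linarith [sq_nonneg ‖block₂ x‖])

theorem norm_block₂_le : ‖block₂ x‖ ≤ ‖x‖ := by
  have h := norm_stack_sq (block₁ x) (block₂ x)
  rw [stack_block] at h
  exact (sq_le_sq₀ (norm_nonneg _) (norm_nonneg _)).1 (by linarith [sq_nonneg ‖block₁ x‖])

end Blocks

/-- The first block as a continuous linear map. -/
noncomputable def block₁L (d : ℕ) :
    EuclideanSpace ℝ (Fin d ⊕ Fin d) →L[ℝ] EuclideanSpace ℝ (Fin d) :=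
  LinearMap.toContinuousLinearMap
    { toFun := block₁, map_add' := fun _ _ => rfl, map_smul' := fun _ _ => rfl }

/-- The second block as a continuous linear map. -/
noncomputable def block₂L (d : ℕ) :
    EuclideanSpace ℝ (Fin d ⊕ Fin d) →L[ℝ] EuclideanSpace ℝ (Fin d) :=
  LinearMap.toContinuousLinearMap
    { toFun := block₂, map_add' := fun _ _ => rfl, map_smul' := fun _ _ => rfl }

/-- Stacking two blocks, as a continuous linear map. -/
noncomputable def stackL (d : ℕ) :
    EuclideanSpace ℝ (Fin d) × EuclideanSpace ℝ (Fin d) →L[ℝ]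
      EuclideanSpace ℝ (Fin d ⊕ Fin d) :=
  LinearMap.toContinuousLinearMap
    { toFun := fun x => stack x.1 x.2
      map_add' := fun x y => by
        ext i
        rcases i with i | i <;> rfl
      map_smul' := fun c x => by
        ext i
        rcases i with i | i <;> rfl }

theorem lipschitzWith_block₁ (d : ℕ) : LipschitzWith ‖block₁L d‖₊ (block₁ (d := d)) :=
  (block₁L d).lipschitz

theorem lipschitzWith_block₂ (d : ℕ) : LipschitzWith ‖block₂L d‖₊ (block₂ (d := d)) :=
  (block₂L d).lipschitz

theorem lipschitzWith_stack (d : ℕ) : LipschitzWith ‖stackL d‖₊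
    (fun x : EuclideanSpace ℝ (Fin d) × EuclideanSpace ℝ (Fin d) => stack x.1 x.2) :=
  (stackL d).lipschitz

/-- The input `B w` of the scalar lag `ξ̇ = -η μf μφ' ξ + B w` of the linear part. -/
noncomputable def lureInput (η μf : ℝ) (w : EuclideanSpace ℝ (Fin d ⊕ Fin d)) :
    EuclideanSpace ℝ (Fin d) :=
  -η • (block₁ w + μf • block₂ w)

theorem exists_lipschitzWith_lureInput (d : ℕ) (η μf : ℝ) :
    ∃ K, LipschitzWith K (lureInput (d := d) η μf) :=
  ⟨_, (-η • (block₁L d + μf • block₂L d)).lipschitz⟩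

theorem lureInput_zero (d : ℕ) (η μf : ℝ) : lureInput (d := d) η μf 0 = 0 := by
  simp [lureInput]

theorem IsL2e.lureInput {η μf : ℝ} {u : ℝ → EuclideanSpace ℝ (Fin d ⊕ Fin d)} (hu : IsL2e u) :
    IsL2e (fun t => lureInput η μf (u t)) :=
  let ⟨_, hK⟩ := exists_lipschitzWith_lureInput d η μf
  hu.comp_lipschitz hK (lureInput_zero d η μf)

theorem lureSystem_kernel_apply (η μf μφ' t : ℝ) (w : EuclideanSpace ℝ (Fin d ⊕ Fin d)) :
    Matrix.toEuclideanLin ((lureSystem d η μf μφ').kernel t) w =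
      stack (μφ' • Real.exp (-(η * μf * μφ') * t) • lureInput η μf w)
        (Real.exp (-(η * μf * μφ') * t) • lureInput η μf w) := by
  rw [LinearSystem.kernel, lureSystem_exp, Matrix.mul_smul, Matrix.mul_one, Matrix.smul_mul,
    lureSystem_C_mul_B]
  ext i
  rcases i with i | i <;>
    simp [stack, lureInput, block₁, block₂, Matrix.toLpLin_apply, Matrix.neg_mulVec, Matrix.smul_mulVec,
      Matrix.fromBlocks_mulVec, Function.comp_def] <;> ring

/-- The linear part is a single lag with state `ξ`, followed by `v = (μφ' ξ + w₂, ξ)`. -/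
theorem lureSystem_operator_apply (η μf μφ' : ℝ) {u : ℝ → EuclideanSpace ℝ (Fin d ⊕ Fin d)}
    {t : ℝ} (hu : IntervalIntegrable (fun s => lureInput η μf (u s)) volume 0 t) :
    (lureSystem d η μf μφ').operator u t =
      stack (μφ' • lag (η * μf * μφ') (fun s => lureInput η μf (u s)) t + block₂ (u t))
        (lag (η * μf * μφ') (fun s => lureInput η μf (u s)) t) := by
  set ξ := lag (η * μf * μφ') (fun s => lureInput η μf (u s)) t with hξ
  have hi : IntervalIntegrable (fun s => Real.exp (-(η * μf * μφ') * (t - s)) •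
      lureInput η μf (u s)) volume 0 t := hu.continuousOn_smul (by fun_prop)
  have h1 : ∫ s in (0 : ℝ)..t,
      Matrix.toEuclideanLin ((lureSystem d η μf μφ').kernel (t - s)) (u s) =
      stack (μφ' • ξ) ξ := by
    have h := ((stackL d).comp ((μφ' • ContinuousLinearMap.id ℝ _).prod
      (ContinuousLinearMap.id ℝ _))).intervalIntegral_comp_comm hi
    simp_rw [lureSystem_kernel_apply]
    exact h
  have h2 : Matrix.toEuclideanLin (lureSystem d η μf μφ').D (u t) = stack (block₂ (u t)) 0 := by
    ext i
    rcases i with i | i <;>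
      simp [stack, lureSystem, block₂, Matrix.toLpLin_apply, Matrix.fromBlocks_mulVec,
        Function.comp_def]
  rw [LinearSystem.operator, h1, h2]
  ext i
  rcases i with i | i <;> simp [stack]

theorem isCausalOperator_lureSystem (d : ℕ) (η μf μφ' : ℝ) :
    IsCausalOperator (lureSystem d η μf μφ').operator := by
  refine .of_forall_ae_eq (fun u hu => ?_) fun u v hu hv T hT huv => ?_
  · have hξ : IsL2e (lag (η * μf * μφ') (fun s => lureInput η μf (u s))) :=
      .of_continuousOn (continuousOn_lag _ fun T hT => hu.lureInput.intervalIntegrable hT)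
    have h2 : IsL2e (fun t => block₂ (u t)) :=
      hu.comp_lipschitz (block₂L d).lipschitz (map_zero _)
    have h1 : IsL2e (fun t => μφ' • lag (η * μf * μφ') (fun s => lureInput η μf (u s)) t) :=
      hξ.comp_lipschitz (μφ' • ContinuousLinearMap.id ℝ _).lipschitz (map_zero _)
    refine (((h1.add h2).prodMk hξ).comp_lipschitz (stackL d).lipschitz (map_zero _)).congr_on
      fun t ht => ?_
    exact (lureSystem_operator_apply η μf μφ' (hu.lureInput.intervalIntegrable ht)).symm
  · filter_upwards [huv, ae_restrict_mem measurableSet_Icc] with t ht htT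
    rw [lureSystem_operator_apply η μf μφ' (hu.lureInput.intervalIntegrable htT.1),
      lureSystem_operator_apply η μf μφ' (hv.lureInput.intervalIntegrable htT.1), ht,
      lag_congr (r := fun s => lureInput η μf (v s)) (huv.mono fun s hs => by simp only [hs]) htT]

/-! ### The feedback loop -/

/-- The static operator `(v₁, v₂) ↦ (Δ₁ v₁, Δ₂ v₂)`. -/
noncomputable def blockDiag
    (Δ₁ Δ₂ : EuclideanSpace ℝ (Fin d) → EuclideanSpace ℝ (Fin d))
    (y : EuclideanSpace ℝ (Fin d ⊕ Fin d)) : EuclideanSpace ℝ (Fin d ⊕ Fin d) :=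
  stack (Δ₁ (block₁ y)) (Δ₂ (block₂ y))

/-- The space of values of `(v, w)` and of `(g, e)`. -/
abbrev LoopSpace (d : ℕ) : Type :=
  WithLp 2 (EuclideanSpace ℝ (Fin d ⊕ Fin d) × EuclideanSpace ℝ (Fin d ⊕ Fin d))

theorem exists_lipschitzWith_blockDiag
    {Δ₁ Δ₂ : EuclideanSpace ℝ (Fin d) → EuclideanSpace ℝ (Fin d)}
    (h₁ : ∃ K, LipschitzWith K Δ₁) (h₂ : ∃ K, LipschitzWith K Δ₂) :
    ∃ K, LipschitzWith K (blockDiag Δ₁ Δ₂) := by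
  obtain ⟨_, h₁⟩ := h₁
  obtain ⟨_, h₂⟩ := h₂
  have h := (h₁.comp (lipschitzWith_block₁ d)).prodMk (h₂.comp (lipschitzWith_block₂ d))
  have h' := (lipschitzWith_stack d).comp h
  exact ⟨_, h'⟩

theorem blockDiag_zero {Δ₁ Δ₂ : EuclideanSpace ℝ (Fin d) → EuclideanSpace ℝ (Fin d)}
    (h₁ : Δ₁ 0 = 0) (h₂ : Δ₂ 0 = 0) : blockDiag Δ₁ Δ₂ 0 = 0 := by
  simp [blockDiag, h₁, h₂]

/-- The projection to `v`, or to `g`. -/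
noncomputable abbrev loopFstL (d : ℕ) : LoopSpace d →L[ℝ] EuclideanSpace ℝ (Fin d ⊕ Fin d) :=
  WithLp.fstL 2 ℝ _ _

/-- The projection to `w`, or to `e`. -/
noncomputable abbrev loopSndL (d : ℕ) : LoopSpace d →L[ℝ] EuclideanSpace ℝ (Fin d ⊕ Fin d) :=
  WithLp.sndL 2 ℝ _ _

/-- Pairing, as a continuous linear map. -/
noncomputable abbrev loopToLpL (d : ℕ) :
    EuclideanSpace ℝ (Fin d ⊕ Fin d) × EuclideanSpace ℝ (Fin d ⊕ Fin d) →L[ℝ] LoopSpace d :=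
  (WithLp.prodContinuousLinearEquiv 2 ℝ _ _).symm.toContinuousLinearMap

theorem IsL2e.fst {p : ℝ → LoopSpace d} (hp : IsL2e p) : IsL2e (fun t => (p t).fst) :=
  hp.comp_lipschitz (D := fun x : LoopSpace d => x.fst) (loopFstL d).lipschitz rfl

theorem IsL2e.snd {p : ℝ → LoopSpace d} (hp : IsL2e p) : IsL2e (fun t => (p t).snd) :=
  hp.comp_lipschitz (D := fun x : LoopSpace d => x.snd) (loopSndL d).lipschitz rfl

theorem IsL2e.toLp {v w : ℝ → EuclideanSpace ℝ (Fin d ⊕ Fin d)} (hv : IsL2e v) (hw : IsL2e w) :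
    IsL2e (fun t => (WithLp.toLp 2 (v t, w t) : LoopSpace d)) :=
  (hv.prodMk hw).comp_lipschitz (D := fun x => (WithLp.toLp 2 x : LoopSpace d))
    (loopToLpL d).lipschitz rfl

section Loop

variable (μφ' : ℝ) (Δ₁ Δ₂ : EuclideanSpace ℝ (Fin d) → EuclideanSpace ℝ (Fin d))
  (x : EuclideanSpace ℝ (Fin d) × LoopSpace d)

/-- The signal `v₂ = ξ + g₂` as a function of the state `ξ` and the external input `(g, e)`. -/
noncomputable def loopV₂ : EuclideanSpace ℝ (Fin d) := x.1 + block₂ x.2.fst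

/-- The signal `w₂ = Δ₂ v₂ + e₂`. -/
noncomputable def loopW₂ : EuclideanSpace ℝ (Fin d) := Δ₂ (loopV₂ x) + block₂ x.2.snd

/-- The signal `v₁ = μφ' ξ + w₂ + g₁`. -/
noncomputable def loopV₁ : EuclideanSpace ℝ (Fin d) :=
  μφ' • x.1 + loopW₂ Δ₂ x + block₁ x.2.fst

/-- The signal `w₁ = Δ₁ v₁ + e₁`. -/
noncomputable def loopW₁ : EuclideanSpace ℝ (Fin d) :=
  Δ₁ (loopV₁ μφ' Δ₂ x) + block₁ x.2.snd

/-- The loop signals `(v, w)` as a function of the state `ξ` and the external input `(g, e)`. The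
feedthrough of the linear part acts only from `w₂` to `v₁`, so they can be computed one
after the other, in the order `v₂, w₂, v₁, w₁`. -/
noncomputable def loopSignals : LoopSpace d :=
  WithLp.toLp 2 (stack (loopV₁ μφ' Δ₂ x) (loopV₂ x),
    stack (loopW₁ μφ' Δ₁ Δ₂ x) (loopW₂ Δ₂ x))

variable {μφ' Δ₁ Δ₂}

theorem exists_lipschitzWith_loopSignals (h₁ : ∃ K, LipschitzWith K Δ₁)
    (h₂ : ∃ K, LipschitzWith K Δ₂) : ∃ K, LipschitzWith K (loopSignals μφ' Δ₁ Δ₂) := by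
  obtain ⟨_, h₁⟩ := h₁
  obtain ⟨_, h₂⟩ := h₂
  let X := EuclideanSpace ℝ (Fin d)
  let fstL : X × LoopSpace d →L[ℝ] EuclideanSpace ℝ (Fin d ⊕ Fin d) :=
    (loopFstL d).comp (ContinuousLinearMap.snd ℝ X (LoopSpace d))
  let sndL : X × LoopSpace d →L[ℝ] EuclideanSpace ℝ (Fin d ⊕ Fin d) :=
    (loopSndL d).comp (ContinuousLinearMap.snd ℝ X (LoopSpace d))
  have hV₂ := (ContinuousLinearMap.fst ℝ X (LoopSpace d) + (block₂L d).comp fstL).lipschitz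
  have hW₂ := (h₂.comp hV₂).add ((block₂L d).comp sndL).lipschitz
  have hV₁ := ((μφ' • ContinuousLinearMap.fst ℝ X (LoopSpace d)).lipschitz.add hW₂).add
    ((block₁L d).comp fstL).lipschitz
  have hW₁ := (h₁.comp hV₁).add ((block₁L d).comp sndL).lipschitz
  have hv := (lipschitzWith_stack d).comp (hV₁.prodMk hV₂)
  have hw := (lipschitzWith_stack d).comp (hW₁.prodMk hW₂)
  have h := (loopToLpL d).lipschitz.comp (hv.prodMk hw)
  exact ⟨_, h⟩

theorem loopSignals_zero (h₁ : Δ₁ 0 = 0) (h₂ : Δ₂ 0 = 0) : loopSignals μφ' Δ₁ Δ₂ 0 = 0 := by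
  simp [loopSignals, loopW₁, loopV₁, loopW₂, loopV₂, h₁, h₂]

variable {G : (ℝ → EuclideanSpace ℝ (Fin d ⊕ Fin d)) → ℝ → EuclideanSpace ℝ (Fin d ⊕ Fin d)}
  {p : ℝ → LoopSpace d} {t : ℝ} {ξ : EuclideanSpace ℝ (Fin d)}

/-- The loop signals `p` are recovered from the state and the external signal `loopMap G Δ p`, for
an operator `G` whose output at time `t` has the form `(μφ' ξ + w₂, ξ)`. -/
theorem eq_loopSignals_loopMap
    (hG : G (fun s => (p s).snd) t = stack (μφ' • ξ + block₂ (p t).snd) ξ) :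
    p t = loopSignals μφ' Δ₁ Δ₂ (ξ, loopMap G (fun v s => blockDiag Δ₁ Δ₂ (v s)) p t) := by
  have h2 : loopV₂ (ξ, loopMap G (fun v s => blockDiag Δ₁ Δ₂ (v s)) p t) = block₂ (p t).fst := by
    simp [loopV₂, loopMap, hG]
  have h3 : loopW₂ Δ₂ (ξ, loopMap G (fun v s => blockDiag Δ₁ Δ₂ (v s)) p t) =
      block₂ (p t).snd := by
    rw [loopW₂, h2]
    simp [loopMap, blockDiag]
  have h1 : loopV₁ μφ' Δ₂ (ξ, loopMap G (fun v s => blockDiag Δ₁ Δ₂ (v s)) p t) =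
      block₁ (p t).fst := by
    rw [loopV₁, h3]
    simp [loopMap, hG]
  have h4 : loopW₁ μφ' Δ₁ Δ₂ (ξ, loopMap G (fun v s => blockDiag Δ₁ Δ₂ (v s)) p t) =
      block₁ (p t).snd := by
    rw [loopW₁, h1]
    simp [loopMap, blockDiag]
  rw [loopSignals, h1, h2, h3, h4, stack_block, stack_block]
  rfl

/-- The converse of `eq_loopSignals_loopMap`. -/
theorem loopMap_eq_of_eq_loopSignals {h : LoopSpace d}
    (hp : p t = loopSignals μφ' Δ₁ Δ₂ (ξ, h))
    (hG : G (fun s => (p s).snd) t = stack (μφ' • ξ + block₂ (p t).snd) ξ) :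
    loopMap G (fun v s => blockDiag Δ₁ Δ₂ (v s)) p t = h := by
  have e1 : (loopMap G (fun v s => blockDiag Δ₁ Δ₂ (v s)) p t).fst = h.fst := by
    rw [← stack_block (loopMap _ _ p t).fst, ← stack_block h.fst]
    congr 1
    · simp [loopMap, hG, hp, loopSignals, loopV₁, add_assoc]
    · simp [loopMap, hG, hp, loopSignals, loopV₂]
  have e2 : (loopMap G (fun v s => blockDiag Δ₁ Δ₂ (v s)) p t).snd = h.snd := by
    rw [← stack_block (loopMap _ _ p t).snd, ← stack_block h.snd]
    congr 1
    · simp [loopMap, hp, loopSignals, blockDiag, loopW₁]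
    · simp [loopMap, hp, loopSignals, blockDiag, loopW₂]
  exact WithLp.ofLp_injective 2 (Prod.ext e1 e2)

end Loop

end MirrorDescent

/-! ### Well-posedness and finite gain of the loop -/

namespace MirrorDescent

section Stability

variable {d : ℕ} {η μf μφ' : ℝ} {Δ₁ Δ₂ : EuclideanSpace ℝ (Fin d) → EuclideanSpace ℝ (Fin d)}

/-- The right-hand side `N(ξ, h)` of the closed loop equation `ξ = lag (N(ξ, h))`. -/
noncomputable def loopInput (η μf μφ' : ℝ)
    (Δ₁ Δ₂ : EuclideanSpace ℝ (Fin d) → EuclideanSpace ℝ (Fin d))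
    (x : EuclideanSpace ℝ (Fin d) × LoopSpace d) : EuclideanSpace ℝ (Fin d) :=
  lureInput η μf (loopSignals μφ' Δ₁ Δ₂ x).snd

theorem exists_lipschitzWith_loopInput (h₁ : ∃ K, LipschitzWith K Δ₁)
    (h₂ : ∃ K, LipschitzWith K Δ₂) : ∃ K, LipschitzWith K (loopInput η μf μφ' Δ₁ Δ₂) := by
  obtain ⟨_, h⟩ := exists_lipschitzWith_loopSignals (μφ' := μφ') h₁ h₂
  obtain ⟨_, h'⟩ := exists_lipschitzWith_lureInput d η μf
  have h'' := h'.comp ((loopSndL d).lipschitz.comp h)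
  exact ⟨_, h''⟩

theorem loopInput_zero (h₁ : Δ₁ 0 = 0) (h₂ : Δ₂ 0 = 0) :
    loopInput η μf μφ' Δ₁ Δ₂ 0 = 0 := by
  rw [loopInput, loopSignals_zero h₁ h₂, WithLp.zero_snd, lureInput_zero]

/-- Well-posedness: every external signal in `L₂ₑ` determines a unique state of the loop, and the
loop signals are a static function of the state and the external signal. -/
theorem exists_isCausalInverse (h₁ : ∃ K, LipschitzWith K Δ₁) (h₂ : ∃ K, LipschitzWith K Δ₂)
    (h₁0 : Δ₁ 0 = 0) (h₂0 : Δ₂ 0 = 0) :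
    ∃ Ξ : (ℝ → LoopSpace d) → ℝ → EuclideanSpace ℝ (Fin d),
      (∀ h, IsL2e h → ContinuousOn (Ξ h) (Ici 0) ∧ ∀ t, 0 ≤ t →
        Ξ h t = lag (η * μf * μφ') (fun s => loopInput η μf μφ' Δ₁ Δ₂ (Ξ h s, h s)) t) ∧
      IsCausalInverse (lureSystem d η μf μφ').operator (fun v t => blockDiag Δ₁ Δ₂ (v t))
        (fun h t => loopSignals μφ' Δ₁ Δ₂ (Ξ h t, h t)) := by
  obtain ⟨KN, hN⟩ := exists_lipschitzWith_loopInput (η := η) (μf := μf) (μφ' := μφ') h₁ h₂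
  have hN0 := loopInput_zero (η := η) (μf := μf) (μφ' := μφ') h₁0 h₂0
  obtain ⟨KS, hS⟩ := exists_lipschitzWith_loopSignals (μφ' := μφ') h₁ h₂
  have hS0 := loopSignals_zero (μφ' := μφ') h₁0 h₂0
  choose! Ξ hΞc hΞ using fun (h : ℝ → LoopSpace d) (hh : IsL2e h) =>
    exists_eq_lag hN hN0 (η * μf * μφ') hh
  have hmaps : ∀ h, IsL2e h → IsL2e (fun t => loopSignals μφ' Δ₁ Δ₂ (Ξ h t, h t)) :=
    fun h hh => ((IsL2e.of_continuousOn (hΞc h hh)).prodMk hh).comp_lipschitz hS hS0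
  refine ⟨Ξ, fun h hh => ⟨hΞc h hh, hΞ h hh⟩, ?_, fun h hh => ?_, fun p hp => ?_⟩
  · refine .of_forall_ae_eq hmaps fun h h' hh hh' T hT hhh => ?_
    have he := eqOn_Icc_of_eq_lag hN hN0 hT hh hhh ((hΞc h hh).mono Icc_subset_Ici_self)
      ((hΞc h' hh').mono Icc_subset_Ici_self) (fun t ht => hΞ h hh t ht.1)
      (fun t ht => hΞ h' hh' t ht.1)
    filter_upwards [hhh, ae_restrict_mem measurableSet_Icc] with t ht htT
    rw [ht, he htT]
  · refine (ae_restrict_mem measurableSet_Ici).mono fun t ht => ?_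
    refine loopMap_eq_of_eq_loopSignals (ξ := Ξ h t) rfl ?_
    rw [lureSystem_operator_apply η μf μφ'
      ((IsL2e.snd (hmaps h hh)).lureInput.intervalIntegrable ht)]
    exact congrArg₂ stack (congrArg₂ _ (congrArg _ (hΞ h hh t ht).symm) rfl)
      (hΞ h hh t ht).symm
  · -- The state belonging to the loop signals `p` solves the closed loop equation for the external
    -- signal `loopMap G Δ p`, so it is the one selected by `Ξ`.
    set q := fun s => lureInput η μf (p s).snd with hq
    have hqi : IsL2e q := (IsL2e.snd hp).lureInput
    have hG : ∀ t, 0 ≤ t → (lureSystem d η μf μφ').operator (fun s => (p s).snd) t =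
        stack (μφ' • lag (η * μf * μφ') q t + block₂ (p t).snd) (lag (η * μf * μφ') q t) :=
      fun t ht => lureSystem_operator_apply η μf μφ' (hqi.intervalIntegrable ht)
    set h := loopMap (lureSystem d η μf μφ').operator (fun v t => blockDiag Δ₁ Δ₂ (v t)) p
      with hdef
    have hpt : ∀ t, 0 ≤ t → p t = loopSignals μφ' Δ₁ Δ₂ (lag (η * μf * μφ') q t, h t) :=
      fun t ht => eq_loopSignals_loopMap (hG t ht)
    have hh : IsL2e h := by
      obtain ⟨_, hD⟩ := exists_lipschitzWith_blockDiag h₁ h₂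
      exact (hp.fst.sub ((isCausalOperator_lureSystem d η μf μφ').mapsTo _ hp.snd)).toLp
        (hp.snd.sub (hp.fst.comp_lipschitz hD (blockDiag_zero h₁0 h₂0)))
    refine (ae_restrict_mem measurableSet_Ici).mono fun t ht => ?_
    have he := eqOn_Icc_of_eq_lag hN hN0 ht hh EventuallyEq.rfl
      ((hΞc h hh).mono Icc_subset_Ici_self)
      ((continuousOn_lag (η * μf * μφ') fun T hT => hqi.intervalIntegrable hT).mono
        Icc_subset_Ici_self) (fun t ht => hΞ h hh t ht.1)
      (fun t ht => lag_congr (r := fun s => loopInput η μf μφ' Δ₁ Δ₂ (lag (η * μf * μφ') q s, h s))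
        ((ae_restrict_mem measurableSet_Icc).mono fun s hs => by
          simp only [hq, loopInput]
          rw [← hpt s hs.1]) ht) (right_mem_Icc.2 ht)
    change loopSignals μφ' Δ₁ Δ₂ (Ξ h t, h t) = p t
    rw [he, hpt t ht]

/-- A convex storage function `V` with minimum value `V 0 = 0`, dissipated along the closed loop up
to the energy of the external signal, gives stability: the integrated dissipation inequality
bounds the state in `L₂[0, T]` by the external signal, uniformly in `T`. -/
theorem isStableInterconnection_of_dissipation
    (h₁ : ∃ K, LipschitzWith K Δ₁) (h₂ : ∃ K, LipschitzWith K Δ₂)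
    (h₁0 : Δ₁ 0 = 0) (h₂0 : Δ₂ 0 = 0)
    {V : EuclideanSpace ℝ (Fin d) → ℝ} {p : EuclideanSpace ℝ (Fin d) → EuclideanSpace ℝ (Fin d)}
    (hp : Continuous p) (hVp : ∀ x, HasGradientAt V (p x) x)
    (hV : ∀ x y, inner ℝ (p x) (y - x) ≤ V y - V x) (hV0 : V 0 = 0) (hVnn : ∀ x, 0 ≤ V x)
    {c K : ℝ} (hc : 0 < c) (hK : 0 ≤ K)
    (hdiss : ∀ x h, inner ℝ (p x) (-(η * μf * μφ') • x + loopInput η μf μφ' Δ₁ Δ₂ (x, h)) ≤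
      -(c * ‖x‖ ^ 2) + K * ‖h‖ ^ 2) :
    IsStableInterconnection (lureSystem d η μf μφ').operator
      (fun v t => blockDiag Δ₁ Δ₂ (v t)) := by
  obtain ⟨KN, hN⟩ := exists_lipschitzWith_loopInput (η := η) (μf := μf) (μφ' := μφ') h₁ h₂
  have hN0 := loopInput_zero (η := η) (μf := μf) (μφ' := μφ') h₁0 h₂0
  obtain ⟨KS, hS⟩ := exists_lipschitzWith_loopSignals (μφ' := μφ') h₁ h₂
  have hS0 := loopSignals_zero (μφ' := μφ') h₁0 h₂0
  obtain ⟨Ξ, hΞ, hR⟩ :=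
    exists_isCausalInverse (η := η) (μf := μf) (μφ' := μφ') h₁ h₂ h₁0 h₂0
  -- The summand `1` only makes the gain positive when the loop signals vanish identically.
  refine ⟨isCausalOperator_lureSystem d η μf μφ', ?_, _, hR,
    KS ^ 2 * (K / c + 1) + 1, by positivity, fun h hh T hT => ?_⟩
  · obtain ⟨_, hD⟩ := exists_lipschitzWith_blockDiag h₁ h₂
    exact .of_lipschitz hD (blockDiag_zero h₁0 h₂0)
  obtain ⟨hξc, hξ⟩ := hΞ h hh
  set ξ := Ξ h with hξdef
  have hξL : IsL2e ξ := .of_continuousOn hξc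
  set q := fun s => loopInput η μf μφ' Δ₁ Δ₂ (ξ s, h s) with hq
  have hqL : IsL2e q := (hξL.prodMk hh).comp_lipschitz hN hN0
  have hξi := hξL.intervalIntegrable_norm_sq hT
  have hhi := hh.intervalIntegrable_norm_sq hT
  have hstate : c * ∫ t in (0 : ℝ)..T, ‖ξ t‖ ^ 2 ≤ K * ∫ t in (0 : ℝ)..T, ‖h t‖ ^ 2 := by
    have h := (absolutelyContinuousOnInterval_lag (η * μf * μφ')
      (hqL.intervalIntegrable hT)).sub_le_integral_of_inner_le hp hVp hV hT
      (ae_hasDerivAt_lag (η * μf * μφ') (hqL.intervalIntegrable hT))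
      (r := fun t => -(c * ‖ξ t‖ ^ 2) + K * ‖h t‖ ^ 2)
      ((hξi.const_mul c).neg.add (hhi.const_mul K)) fun t ht => by
        rw [← hξ t ht.1]
        exact hdiss (ξ t) (h t)
    rw [lag_zero, hV0, intervalIntegral.integral_add (f := fun t => -(c * ‖ξ t‖ ^ 2)) (hξi.const_mul c).neg (hhi.const_mul K),
      intervalIntegral.integral_neg, intervalIntegral.integral_const_mul,
      intervalIntegral.integral_const_mul] at h
    linarith [hVnn (lag (η * μf * μφ') q T)]
  have hpt : ∀ t, ‖loopSignals μφ' Δ₁ Δ₂ (ξ t, h t)‖ ^ 2 ≤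
      KS ^ 2 * (‖ξ t‖ ^ 2 + ‖h t‖ ^ 2) := fun t => by
    have h1 := hS.dist_le_mul (ξ t, h t) 0
    rw [hS0, dist_zero_right, dist_zero_right] at h1
    have h2 : ‖(ξ t, h t)‖ ^ 2 ≤ ‖ξ t‖ ^ 2 + ‖h t‖ ^ 2 := by
      rw [Prod.norm_def]
      rcases max_choice ‖ξ t‖ ‖h t‖ with hm | hm <;> rw [hm]
      · linarith [sq_nonneg ‖h t‖]
      · linarith [sq_nonneg ‖ξ t‖]
    calc _ ≤ (KS * ‖(ξ t, h t)‖) ^ 2 := by gcongr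
      _ = KS ^ 2 * ‖(ξ t, h t)‖ ^ 2 := mul_pow _ _ _
      _ ≤ _ := by gcongr
  have hRi := (hR.isCausal.mapsTo h hh).intervalIntegrable_norm_sq hT
  have hmono := intervalIntegral.integral_mono_on hT hRi ((hξi.add hhi).const_mul ((KS : ℝ) ^ 2))
    fun t _ => hpt t
  rw [intervalIntegral.integral_const_mul, intervalIntegral.integral_add hξi hhi] at hmono
  have h0 : 0 ≤ ∫ t in (0 : ℝ)..T, ‖h t‖ ^ 2 :=
    intervalIntegral.integral_nonneg hT fun t _ => sq_nonneg _
  have hstate' : ∫ t in (0 : ℝ)..T, ‖ξ t‖ ^ 2 ≤ K / c * ∫ t in (0 : ℝ)..T, ‖h t‖ ^ 2 := by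
    rw [div_mul_eq_mul_div, le_div_iff₀ hc]
    linarith
  calc _ ≤ _ := hmono
    _ ≤ (KS : ℝ) ^ 2 * (K / c * (∫ t in (0 : ℝ)..T, ‖h t‖ ^ 2) +
        ∫ t in (0 : ℝ)..T, ‖h t‖ ^ 2) := by gcongr
    _ ≤ _ := by linarith

end Stability

end MirrorDescent

/-! ### The Bregman divergence of the conjugate as a storage function -/

namespace MirrorDescent

section ConjBregman

variable {E : Type*} [NormedAddCommGroup E] [InnerProductSpace ℝ E] [CompleteSpace E]

/-- The Bregman divergence `φ̄ z - φ̄ z₀ - ⟨∇φ̄ z₀, z - z₀⟩` of the convex conjugate. -/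
noncomputable def conjBregman (φ : E → ℝ) (z₀ z : E) : ℝ :=
  conjugate φ z - conjugate φ z₀ - inner ℝ (gradient (conjugate φ) z₀) (z - z₀)

theorem conjBregman_self (φ : E → ℝ) (z₀ : E) : conjBregman φ z₀ z₀ = 0 := by
  simp [conjBregman]

namespace ClassS

variable {μ L : ℝ} {φ : E → ℝ}

theorem conjBregman_eq (hμ : 0 < μ) (hμL : μ ≤ L) (hφ : ClassS μ L φ) (z₀ z : E) :
    conjBregman φ z₀ z = φ (gradient (conjugate φ) z₀) - φ (gradient (conjugate φ) z) -
      inner ℝ (gradient φ (gradient (conjugate φ) z))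
        (gradient (conjugate φ) z₀ - gradient (conjugate φ) z) := by
  have h := hφ.conjugate_bregman hμ.le (gradient (conjugate φ) z₀) (gradient (conjugate φ) z)
  rw [← h, hφ.gradient_gradient_conjugate hμ hμL, hφ.gradient_gradient_conjugate hμ hμL]
  rfl

theorem le_conjBregman (hμ : 0 < μ) (hμL : μ ≤ L) (hφ : ClassS μ L φ) (z₀ z : E) :
    μ / 2 * ‖gradient (conjugate φ) z - gradient (conjugate φ) z₀‖ ^ 2 ≤ conjBregman φ z₀ z := by
  rw [hφ.conjBregman_eq hμ hμL, norm_sub_rev]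
  exact hφ.le_bregman _ _

theorem conjBregman_le (hμ : 0 < μ) (hμL : μ ≤ L) (hφ : ClassS μ L φ) (z₀ z : E) :
    conjBregman φ z₀ z ≤ L / 2 * ‖gradient (conjugate φ) z - gradient (conjugate φ) z₀‖ ^ 2 := by
  rw [hφ.conjBregman_eq hμ hμL, norm_sub_rev]
  exact hφ.bregman_le _ _

theorem conjBregman_nonneg (hμ : 0 < μ) (hμL : μ ≤ L) (hφ : ClassS μ L φ) (z₀ z : E) :
    0 ≤ conjBregman φ z₀ z :=
  le_trans (by positivity) (hφ.le_conjBregman hμ hμL z₀ z)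

theorem inner_le_conjBregman_sub (hμ : 0 < μ) (hμL : μ ≤ L) (hφ : ClassS μ L φ) (z₀ z w : E) :
    inner ℝ (gradient (conjugate φ) z - gradient (conjugate φ) z₀) (w - z) ≤
      conjBregman φ z₀ w - conjBregman φ z₀ z := by
  have h := hφ.conjBregman_nonneg hμ hμL z w
  have e : w - z₀ = (w - z) + (z - z₀) := by abel
  simp only [conjBregman] at h ⊢
  rw [e, inner_add_right, inner_sub_left]
  linarith

theorem hasGradientAt_conjBregman (hμ : 0 < μ) (hμL : μ ≤ L) (hφ : ClassS μ L φ) (z₀ z : E) :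
    HasGradientAt (conjBregman φ z₀)
      (gradient (conjugate φ) z - gradient (conjugate φ) z₀) z := by
  have h1 := hφ.hasGradientAt_conjugate hμ hμL (gradient (conjugate φ) z)
  rw [hφ.gradient_gradient_conjugate hμ hμL] at h1
  have h2 : HasFDerivAt (fun z => inner ℝ (gradient (conjugate φ) z₀) (z - z₀))
      (InnerProductSpace.toDual ℝ E (gradient (conjugate φ) z₀)) z :=
    (InnerProductSpace.toDual ℝ E (gradient (conjugate φ) z₀)).hasFDerivAt.comp z
      ((hasFDerivAt_id z).sub_const z₀)
  rw [hasGradientAt_iff_hasFDerivAt, map_sub]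
  exact (h1.hasFDerivAt.sub_const (conjugate φ z₀)).sub h2

end ClassS

end ConjBregman

/-! ### Stability of the mirror descent loop -/

section Loop

variable {d : ℕ} {μf Lf μφ Lφ η : ℝ} {f φ : EuclideanSpace ℝ (Fin d) → ℝ}

theorem shiftedGrad_zero (h : EuclideanSpace ℝ (Fin d) → ℝ) (μ : ℝ)
    (y₀ : EuclideanSpace ℝ (Fin d)) : shiftedGrad h μ y₀ 0 = 0 := by
  simp [shiftedGrad]

theorem shiftedGrad_eq (h : EuclideanSpace ℝ (Fin d) → ℝ) (μ : ℝ)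
    (y₀ x : EuclideanSpace ℝ (Fin d)) :
    shiftedGrad h μ y₀ x = gradient h (x + y₀) - gradient h y₀ - μ • x := by
  rw [shiftedGrad, smul_add]
  abel

theorem exists_lipschitzWith_shiftedGrad {h : EuclideanSpace ℝ (Fin d) → ℝ} {C : ℝ}
    (hh : ∀ x y, ‖gradient h x - gradient h y‖ ≤ C * ‖x - y‖) (μ : ℝ)
    (y₀ : EuclideanSpace ℝ (Fin d)) : ∃ K, LipschitzWith K (shiftedGrad h μ y₀) := by
  refine ⟨Real.toNNReal (C + |μ|), LipschitzWith.of_dist_le' fun x y => ?_⟩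
  have e : shiftedGrad h μ y₀ x - shiftedGrad h μ y₀ y =
      (gradient h (x + y₀) - gradient h (y + y₀)) - μ • (x - y) := by
    rw [shiftedGrad_eq, shiftedGrad_eq, smul_sub]
    abel
  have h1 := hh (x + y₀) (y + y₀)
  rw [add_sub_add_right_eq_sub] at h1
  rw [dist_eq_norm, dist_eq_norm, e, add_mul]
  refine (norm_sub_le _ _).trans (add_le_add h1 ?_)
  rw [norm_smul, Real.norm_eq_abs]

/-- The deviation of the primal variable from `∇φ̄ z₀`. -/
noncomputable def primalDev (φ : EuclideanSpace ℝ (Fin d) → ℝ)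
    (z₀ ξ : EuclideanSpace ℝ (Fin d)) : EuclideanSpace ℝ (Fin d) :=
  gradient (conjugate φ) (ξ + z₀) - gradient (conjugate φ) z₀

/-- Without external signals the loop is mirror descent in the variable `ξ = z - zopt`: the terms
added to the nonlinearities by the loop transformation cancel. -/
theorem closedLoop_eq (μφ' : ℝ) {xopt zopt : EuclideanSpace ℝ (Fin d)}
    (hf0 : gradient f xopt = 0) (ξ : EuclideanSpace ℝ (Fin d)) (h : LoopSpace d) :
    -(η * μf * μφ') • ξ + loopInput η μf μφ' (shiftedGrad f μf xopt)
        (shiftedGrad (conjugate φ) μφ' zopt) (ξ, h) =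
      -η • (gradient f (primalDev φ zopt (ξ + block₂ h.fst) - μφ' • block₂ h.fst +
        block₂ h.snd + block₁ h.fst + xopt) - μf • block₁ h.fst + block₁ h.snd) := by
  have h2 : loopW₂ (shiftedGrad (conjugate φ) μφ' zopt) (ξ, h) =
      primalDev φ zopt (ξ + block₂ h.fst) - μφ' • (ξ + block₂ h.fst) + block₂ h.snd := by
    rw [loopW₂, loopV₂, shiftedGrad_eq, primalDev]
  have h1 : loopV₁ μφ' (shiftedGrad (conjugate φ) μφ' zopt) (ξ, h) =
      primalDev φ zopt (ξ + block₂ h.fst) - μφ' • block₂ h.fst + block₂ h.snd +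
        block₁ h.fst := by
    rw [loopV₁, h2, smul_add]
    abel
  have h3 : loopInput η μf μφ' (shiftedGrad f μf xopt)
      (shiftedGrad (conjugate φ) μφ' zopt) (ξ, h) =
      -η • (loopW₁ μφ' (shiftedGrad f μf xopt) (shiftedGrad (conjugate φ) μφ' zopt) (ξ, h) +
        μf • loopW₂ (shiftedGrad (conjugate φ) μφ' zopt) (ξ, h)) := rfl
  rw [h3, loopW₁, h1, h2, shiftedGrad_eq, hf0]
  module

/-- The dissipation inequality for the Bregman divergence of the conjugate. -/
theorem inner_closedLoop_le (hμf : 0 < μf) (hμLf : μf ≤ Lf) (hμφ : 0 < μφ) (hμLφ : μφ ≤ Lφ)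
    (hη : 0 < η) (hf : ClassS μf Lf f) (hφ : ClassS μφ Lφ φ)
    {zopt : EuclideanSpace ℝ (Fin d)} (hf0 : gradient f (gradient (conjugate φ) zopt) = 0)
    (ξ : EuclideanSpace ℝ (Fin d)) (h : LoopSpace d) :
    inner ℝ (primalDev φ zopt ξ) (-(η * μf * Lφ⁻¹) • ξ +
      loopInput η μf Lφ⁻¹ (shiftedGrad f μf (gradient (conjugate φ) zopt))
        (shiftedGrad (conjugate φ) Lφ⁻¹ zopt) (ξ, h)) ≤
      -(η * μf / (2 * Lφ ^ 2) * ‖ξ‖ ^ 2) +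
        η * (Lf * (μφ⁻¹ + Lφ⁻¹ + 2) + μf + 1) ^ 2 / (2 * μf) * ‖h‖ ^ 2 := by
  have hLf : 0 < Lf := hμf.trans_le hμLf
  have hLφ : 0 < Lφ := hμφ.trans_le hμLφ
  set xopt := gradient (conjugate φ) zopt with hxopt
  set P := primalDev φ zopt ξ with hP
  set b := Lf * (μφ⁻¹ + Lφ⁻¹ + 2) + μf + 1 with hb
  rw [closedLoop_eq Lφ⁻¹ hf0]
  set Y := primalDev φ zopt (ξ + block₂ h.fst) - Lφ⁻¹ • block₂ h.fst + block₂ h.snd +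
    block₁ h.fst with hY
  have hfst : ‖h.fst‖ ≤ ‖h‖ := WithLp.norm_fst_le _ _
  have hsnd : ‖h.snd‖ ≤ ‖h‖ := WithLp.norm_snd_le _ _
  have g1 := (norm_block₁_le h.fst).trans hfst
  have g2 := (norm_block₂_le h.fst).trans hfst
  have e1 := (norm_block₁_le h.snd).trans hsnd
  have e2 := (norm_block₂_le h.snd).trans hsnd
  have hPY : ‖Y - P‖ ≤ (μφ⁻¹ + Lφ⁻¹ + 2) * ‖h‖ := by
    have e : Y - P = (gradient (conjugate φ) (ξ + block₂ h.fst + zopt) -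
        gradient (conjugate φ) (ξ + zopt)) + -(Lφ⁻¹ • block₂ h.fst) + block₂ h.snd +
        block₁ h.fst := by
      rw [hY, hP, primalDev, primalDev]
      abel
    have h1 := hφ.norm_gradient_conjugate_sub_le hμφ hμLφ (ξ + block₂ h.fst + zopt) (ξ + zopt)
    have e' : ξ + block₂ h.fst + zopt - (ξ + zopt) = block₂ h.fst := by abel
    rw [e'] at h1
    have h2 : ‖-(Lφ⁻¹ • block₂ h.fst)‖ ≤ Lφ⁻¹ * ‖h‖ := by
      rw [norm_neg, norm_smul, Real.norm_of_nonneg (inv_nonneg.2 hLφ.le)]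
      gcongr
    have h3 : μφ⁻¹ * ‖block₂ h.fst‖ ≤ μφ⁻¹ * ‖h‖ := by gcongr
    rw [e]
    refine (norm_add_le _ _).trans ?_
    have h4 := norm_add_le ((gradient (conjugate φ) (ξ + block₂ h.fst + zopt) -
        gradient (conjugate φ) (ξ + zopt)) + -(Lφ⁻¹ • block₂ h.fst)) (block₂ h.snd)
    have h5 := norm_add_le (gradient (conjugate φ) (ξ + block₂ h.fst + zopt) -
        gradient (conjugate φ) (ξ + zopt)) (-(Lφ⁻¹ • block₂ h.fst))
    linarith
  -- The gradient of `f` at `Y + xopt` is split into its value at `P + xopt`, which is strongly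
  -- monotone in `P`, and a remainder of size `‖h‖`.
  have hmono : μf * ‖P‖ ^ 2 ≤ inner ℝ P (gradient f (P + xopt)) := by
    have h1 := hf.lower (P + xopt) xopt
    rwa [hf0, sub_zero, add_sub_cancel_right, real_inner_comm] at h1
  set q := (gradient f (Y + xopt) - gradient f (P + xopt)) - μf • block₁ h.fst + block₁ h.snd
    with hq
  have hqn : ‖q‖ ≤ b * ‖h‖ := by
    have h1 := hf.norm_gradient_sub_le hμf.le hLf (Y + xopt) (P + xopt)
    rw [add_sub_add_right_eq_sub] at h1
    have h2 : Lf * ‖Y - P‖ ≤ Lf * ((μφ⁻¹ + Lφ⁻¹ + 2) * ‖h‖) := by gcongr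
    have h3 : ‖μf • block₁ h.fst‖ ≤ μf * ‖h‖ := by
      rw [norm_smul, Real.norm_of_nonneg hμf.le]
      gcongr
    have h4 := norm_sub_le (gradient f (Y + xopt) - gradient f (P + xopt)) (μf • block₁ h.fst)
    refine (norm_add_le _ _).trans ?_
    rw [hb]
    linarith
  have hin : -(‖P‖ * (b * ‖h‖)) ≤ inner ℝ P q := by
    have h1 := (abs_le.1 (abs_real_inner_le_norm P q)).1
    have h2 : ‖P‖ * ‖q‖ ≤ ‖P‖ * (b * ‖h‖) := by gcongr
    linarith
  have hξP : ‖ξ‖ ≤ Lφ * ‖P‖ := by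
    have h1 := hφ.norm_sub_le_gradient_conjugate hμφ hμLφ (ξ + zopt) zopt
    rwa [add_sub_cancel_right] at h1
  have hsplit : gradient f (Y + xopt) - μf • block₁ h.fst + block₁ h.snd =
      gradient f (P + xopt) + q := by
    rw [hq]
    abel
  rw [hsplit, inner_smul_right, inner_add_right]
  -- Young's inequality spends half of the strong monotonicity on the perturbation.
  have hyoung : ‖P‖ * (b * ‖h‖) ≤ μf / 2 * ‖P‖ ^ 2 + b ^ 2 / (2 * μf) * ‖h‖ ^ 2 := by
    have e : μf / 2 * ‖P‖ ^ 2 + b ^ 2 / (2 * μf) * ‖h‖ ^ 2 - ‖P‖ * (b * ‖h‖) =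
        (μf * ‖P‖ - b * ‖h‖) ^ 2 / (2 * μf) := by
      field_simp
      ring
    have : 0 ≤ (μf * ‖P‖ - b * ‖h‖) ^ 2 / (2 * μf) := by positivity
    linarith
  have hξ2 : μf / (2 * Lφ ^ 2) * ‖ξ‖ ^ 2 ≤ μf / 2 * ‖P‖ ^ 2 := by
    calc μf / (2 * Lφ ^ 2) * ‖ξ‖ ^ 2 ≤ μf / (2 * Lφ ^ 2) * (Lφ * ‖P‖) ^ 2 := by gcongr
      _ = μf / 2 * ‖P‖ ^ 2 := by field_simp
  have hfin : μf / (2 * Lφ ^ 2) * ‖ξ‖ ^ 2 - b ^ 2 / (2 * μf) * ‖h‖ ^ 2 ≤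
      inner ℝ P (gradient f (P + xopt)) + inner ℝ P q := by linarith
  calc -η * (inner ℝ P (gradient f (P + xopt)) + inner ℝ P q)
      = -(η * (inner ℝ P (gradient f (P + xopt)) + inner ℝ P q)) := by ring
    _ ≤ -(η * (μf / (2 * Lφ ^ 2) * ‖ξ‖ ^ 2 - b ^ 2 / (2 * μf) * ‖h‖ ^ 2)) := by gcongr
    _ = _ := by ring

theorem isStableInterconnection_mirrorDescent (hμf : 0 < μf) (hμLf : μf ≤ Lf) (hμφ : 0 < μφ)
    (hμLφ : μφ ≤ Lφ) (hη : 0 < η) (hf : ClassS μf Lf f) (hφ : ClassS μφ Lφ φ)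
    {zopt : EuclideanSpace ℝ (Fin d)} (hf0 : gradient f (gradient (conjugate φ) zopt) = 0) :
    IsStableInterconnection (lureSystem d η μf Lφ⁻¹).operator
      (lureNonlinearity f (conjugate φ) μf Lφ⁻¹ (gradient (conjugate φ) zopt) zopt) := by
  have hLf : 0 < Lf := hμf.trans_le hμLf
  have hLφ : 0 < Lφ := hμφ.trans_le hμLφ
  have hpc : Continuous (gradient (conjugate φ)) :=
    (LipschitzWith.of_dist_le' fun x y => by
      rw [dist_eq_norm, dist_eq_norm]
      exact hφ.norm_gradient_conjugate_sub_le hμφ hμLφ x y).continuous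
  refine isStableInterconnection_of_dissipation
    (exists_lipschitzWith_shiftedGrad (hf.norm_gradient_sub_le hμf.le hLf) _ _)
    (exists_lipschitzWith_shiftedGrad (hφ.norm_gradient_conjugate_sub_le hμφ hμLφ) _ _)
    (shiftedGrad_zero _ _ _) (shiftedGrad_zero _ _ _)
    (V := fun ξ => conjBregman φ zopt (ξ + zopt)) (p := primalDev φ zopt)
    ((hpc.comp (continuous_id.add continuous_const)).sub continuous_const) (fun ξ => ?_)
    (fun x y => ?_) ?_ (fun x => hφ.conjBregman_nonneg hμφ hμLφ _ _) ?_ ?_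
    (inner_closedLoop_le hμf hμLf hμφ hμLφ hη hf hφ hf0)
  · rw [hasGradientAt_iff_hasFDerivAt]
    exact (hasFDerivAt_comp_add_right zopt).2
      (hφ.hasGradientAt_conjBregman hμφ hμLφ zopt (ξ + zopt)).hasFDerivAt
  · have h := hφ.inner_le_conjBregman_sub hμφ hμLφ zopt (x + zopt) (y + zopt)
    rwa [add_sub_add_right_eq_sub] at h
  · rw [zero_add, conjBregman_self]
  · positivity
  · positivity

/-! ### Trajectories of mirror descent -/

theorem exists_lipschitzWith_field (hμf : 0 < μf) (hμLf : μf ≤ Lf) (hμφ : 0 < μφ)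
    (hμLφ : μφ ≤ Lφ) (hf : ClassS μf Lf f) (hφ : ClassS μφ Lφ φ) (η : ℝ) :
    ∃ K, LipschitzWith K (fun z => -η • gradient f (gradient (conjugate φ) z)) := by
  refine ⟨Real.toNNReal (|η| * (Lf * μφ⁻¹)), LipschitzWith.of_dist_le' fun x y => ?_⟩
  have hLf : 0 < Lf := hμf.trans_le hμLf
  rw [dist_smul₀, norm_neg, Real.norm_eq_abs, dist_eq_norm, dist_eq_norm, mul_assoc, mul_assoc]
  gcongr
  refine (hf.norm_gradient_sub_le hμf.le hLf _ _).trans ?_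
  gcongr
  exact hφ.norm_gradient_conjugate_sub_le hμφ hμLφ x y

/-- A global solution of an autonomous Lipschitz differential equation. -/
theorem exists_hasDerivWithinAt_Ici {E : Type*} [NormedAddCommGroup E] [NormedSpace ℝ E]
    [CompleteSpace E] {F : E → E} {K : NNReal} (hF : LipschitzWith K F) (z₀ : E) :
    ∃ z : ℝ → E, z 0 = z₀ ∧ ∀ t, 0 ≤ t → HasDerivWithinAt z (F (z t)) (Ici 0) t := by
  obtain ⟨y, hyc, hy⟩ := exists_integral_eq_Ici (M := fun _ => F) (K := K + 1) (by positivity)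
    (fun _ x y => by
      have h := hF.dist_le_mul x y
      rw [dist_eq_norm, dist_eq_norm] at h
      linarith [norm_nonneg (x - y)])
    (fun T hT y hy => (hF.continuous.comp_continuousOn
      (by rwa [uIcc_of_le hT])).intervalIntegrable) z₀
  refine ⟨y, by simpa using hy 0 le_rfl, fun t ht => ?_⟩
  -- The integrand is extended to negative times by its value at `0`, so that the fundamental theorem
  -- of calculus applies on the whole line.
  have hc : Continuous fun s => F (y (max 0 s)) :=
    hF.continuous.comp (hyc.comp_continuous (continuous_const.max continuous_id)
      fun s => mem_Ici.2 (le_max_left _ _))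
  have hd : HasDerivAt (fun t => z₀ + ∫ s in (0 : ℝ)..t, F (y (max 0 s))) (F (y (max 0 t))) t :=
    (intervalIntegral.integral_hasDerivAt_right (hc.intervalIntegrable _ _)
      (hc.stronglyMeasurableAtFilter _ _) hc.continuousAt).const_add _
  rw [max_eq_right ht] at hd
  have he : ∀ t ∈ Ici (0 : ℝ), y t = z₀ + ∫ s in (0 : ℝ)..t, F (y (max 0 s)) := fun t ht => by
    rw [hy t ht]
    congr 1
    refine intervalIntegral.integral_congr fun s hs => ?_
    rw [uIcc_of_le ht] at hs
    simp only [max_eq_right hs.1]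
  exact hd.hasDerivWithinAt.congr he (he t ht)

theorem IsTrajectory.eqOn (hμf : 0 < μf) (hμLf : μf ≤ Lf) (hμφ : 0 < μφ)
    (hμLφ : μφ ≤ Lφ) (hf : ClassS μf Lf f) (hφ : ClassS μφ Lφ φ)
    {z₀ : EuclideanSpace ℝ (Fin d)} {z z' : ℝ → EuclideanSpace ℝ (Fin d)}
    (hz : IsTrajectory f φ η z₀ z) (hz' : IsTrajectory f φ η z₀ z') : EqOn z z' (Ici 0) := by
  intro t ht
  obtain ⟨K, hK⟩ := exists_lipschitzWith_field hμf hμLf hμφ hμLφ hf hφ η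
  exact ODE_solution_unique (fun _ => hK)
    (fun s hs => (hz.deriv s hs.1).continuousWithinAt.mono Icc_subset_Ici_self)
    (fun s hs => (hz.deriv s hs.1).mono (Ici_subset_Ici.2 hs.1))
    (fun s hs => (hz'.deriv s hs.1).continuousWithinAt.mono Icc_subset_Ici_self)
    (fun s hs => (hz'.deriv s hs.1).mono (Ici_subset_Ici.2 hs.1))
    (hz.init.trans hz'.init.symm) (right_mem_Icc.2 ht)

/-- The Bregman divergence of the conjugate decays exponentially along mirror descent. -/
theorem IsTrajectory.conjBregman_le (hμf : 0 < μf) (hμφ : 0 < μφ)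
    (hμLφ : μφ ≤ Lφ) (hη : 0 < η) (hf : ClassS μf Lf f) (hφ : ClassS μφ Lφ φ)
    {zopt : EuclideanSpace ℝ (Fin d)} (hf0 : gradient f (gradient (conjugate φ) zopt) = 0)
    {z₀ : EuclideanSpace ℝ (Fin d)} {z : ℝ → EuclideanSpace ℝ (Fin d)}
    (hz : IsTrajectory f φ η z₀ z) {t : ℝ} (ht : 0 ≤ t) :
    conjBregman φ zopt (z t) ≤
      Real.exp (-(2 * η * μf / Lφ * t)) * conjBregman φ zopt z₀ := by
  have hLφ : 0 < Lφ := hμφ.trans_le hμLφ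
  set k := 2 * η * μf / Lφ with hk
  set X := gradient (conjugate φ) with hX
  have hd : ∀ t, 0 ≤ t → HasDerivWithinAt
      (fun t => Real.exp (k * t) * conjBregman φ zopt (z t))
      (Real.exp (k * t) * (k * conjBregman φ zopt (z t) +
        inner ℝ (X (z t) - X zopt) (-η • gradient f (X (z t))))) (Ici 0) t := fun t ht => by
    have h1 : HasDerivAt (fun t : ℝ => Real.exp (k * t)) (Real.exp (k * t) * k) t := by
      simpa using ((hasDerivAt_id t).const_mul k).exp
    have h2 := (hφ.hasGradientAt_conjBregman hμφ hμLφ zopt (z t)).hasFDerivAt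
      |>.comp_hasDerivWithinAt t (hz.deriv t ht)
    refine (h1.hasDerivWithinAt.mul h2).congr_deriv ?_
    simp only [InnerProductSpace.toDual_apply_apply, Function.comp_apply]
    ring
  have hanti : AntitoneOn (fun t => Real.exp (k * t) * conjBregman φ zopt (z t)) (Ici 0) := by
    refine antitoneOn_of_deriv_nonpos (convex_Ici 0)
      (fun t ht => (hd t ht).continuousWithinAt) (fun t ht => ?_) fun t ht => ?_ <;>
      rw [interior_Ici] at ht <;>
      have hda := (hd t (le_of_lt ht)).hasDerivAt (Ici_mem_nhds ht)
    · exact hda.differentiableAt.differentiableWithinAt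
    · rw [hda.deriv]
      refine mul_nonpos_of_nonneg_of_nonpos (Real.exp_pos _).le ?_
      have h1 := hf.lower (X (z t)) (X zopt)
      rw [hf0, sub_zero, real_inner_comm] at h1
      have h2 := hφ.conjBregman_le hμφ hμLφ zopt (z t)
      have h3 : k * conjBregman φ zopt (z t) ≤ η * (μf * ‖X (z t) - X zopt‖ ^ 2) :=
        calc _ ≤ k * (Lφ / 2 * ‖X (z t) - X zopt‖ ^ 2) := by gcongr
          _ = _ := by rw [hk]; field_simp
      have h4 := mul_le_mul_of_nonneg_left h1 hη.le
      rw [inner_smul_right]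
      linarith
  have h := hanti self_mem_Ici ht ht
  simp only [mul_zero, Real.exp_zero, one_mul, hz.init] at h
  rw [Real.exp_neg, le_inv_mul_iff₀ (Real.exp_pos _)]
  exact h

theorem IsTrajectory.tendsto (hμf : 0 < μf) (hμφ : 0 < μφ)
    (hμLφ : μφ ≤ Lφ) (hη : 0 < η) (hf : ClassS μf Lf f) (hφ : ClassS μφ Lφ φ)
    {zopt : EuclideanSpace ℝ (Fin d)} (hf0 : gradient f (gradient (conjugate φ) zopt) = 0)
    {z₀ : EuclideanSpace ℝ (Fin d)} {z : ℝ → EuclideanSpace ℝ (Fin d)}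
    (hz : IsTrajectory f φ η z₀ z) :
    Tendsto (fun t => gradient (conjugate φ) (z t)) atTop
      (𝓝 (gradient (conjugate φ) zopt)) := by
  have hLφ : 0 < Lφ := hμφ.trans_le hμLφ
  have hk : 0 < 2 * η * μf / Lφ := by positivity
  have h1 : Tendsto (fun t : ℝ => 2 / μφ *
      (Real.exp (-(2 * η * μf / Lφ * t)) * conjBregman φ zopt z₀)) atTop (𝓝 0) := by
    have h := Real.tendsto_exp_neg_atTop_nhds_zero.comp (tendsto_id.const_mul_atTop hk)
    simpa using (h.mul_const (conjBregman φ zopt z₀)).const_mul (2 / μφ)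
  have h2 : Tendsto (fun t => ‖gradient (conjugate φ) (z t) - gradient (conjugate φ) zopt‖ ^ 2)
      atTop (𝓝 0) := by
    refine squeeze_zero' (Eventually.of_forall fun t => sq_nonneg _) ?_ h1
    filter_upwards [eventually_ge_atTop 0] with t ht
    have h3 := (hφ.le_conjBregman hμφ hμLφ zopt (z t)).trans
      (hz.conjBregman_le hμf hμφ hμLφ hη hf hφ hf0 ht)
    rw [div_mul_eq_mul_div, le_div_iff₀ hμφ]
    linarith
  rw [tendsto_iff_norm_sub_tendsto_zero]
  simpa using h2.sqrt

end Loop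

end MirrorDescent

theorem mainTheorem3 (d : ℕ) (μf Lf μφ Lφ η : ℝ)
    (hμf : 0 < μf) (hμLf : μf ≤ Lf) (hμφ : 0 < μφ) (hμLφ : μφ ≤ Lφ) (hη : 0 < η)
    (f φ : EuclideanSpace ℝ (Fin d) → ℝ) (hf : ClassS μf Lf f) (hφ : ClassS μφ Lφ φ) :
    ∃ xopt zopt : EuclideanSpace ℝ (Fin d),
      (∀ x, (∀ y, f x ≤ f y) ↔ x = xopt) ∧
      (∀ z, gradient f (gradient (conjugate φ) z) = 0 ↔ z = zopt) ∧
      gradient (conjugate φ) zopt = xopt ∧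
      IsStableInterconnection
        (lureSystem d η μf Lφ⁻¹).operator
        (lureNonlinearity f (conjugate φ) μf Lφ⁻¹ xopt zopt) ∧
      ∀ z₀ : EuclideanSpace ℝ (Fin d), ∃ z : ℝ → EuclideanSpace ℝ (Fin d),
        IsTrajectory f φ η z₀ z ∧
        (∀ z', IsTrajectory f φ η z₀ z' → Set.EqOn z' z (Set.Ici 0)) ∧
        Filter.Tendsto (fun t => gradient (conjugate φ) (z t)) Filter.atTop (nhds xopt) := by
  obtain ⟨xopt, hx⟩ := hf.gradient_surjective hμf hμLf 0
  have hX : gradient (conjugate φ) (gradient φ xopt) = xopt :=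
    hφ.gradient_conjugate_gradient hμφ hμLφ xopt
  have hf0 : gradient f (gradient (conjugate φ) (gradient φ xopt)) = 0 := by rw [hX, hx]
  refine ⟨xopt, gradient φ xopt, fun x => ?_, fun z => ⟨fun h => ?_, ?_⟩, hX, ?_, fun z₀ => ?_⟩
  · rw [hf.forall_le_iff_gradient_eq_zero hμf.le, ← hx]
    exact (hf.gradient_injective hμf).eq_iff
  · rw [← hf.gradient_injective hμf (h.trans hx.symm),
      hφ.gradient_gradient_conjugate hμφ hμLφ]
  · rintro rfl
    exact hf0
  · have h := isStableInterconnection_mirrorDescent hμf hμLf hμφ hμLφ hη hf hφ hf0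
    rwa [hX] at h
  · obtain ⟨K, hK⟩ := exists_lipschitzWith_field hμf hμLf hμφ hμLφ hf hφ η
    obtain ⟨z, hz0, hz⟩ := exists_hasDerivWithinAt_Ici hK z₀
    have ht : IsTrajectory f φ η z₀ z := ⟨hz0, hz⟩
    refine ⟨z, ht, fun z' hz' => hz'.eqOn hμf hμLf hμφ hμLφ hf hφ ht, ?_⟩
    have h := ht.tendsto hμf hμφ hμLφ hη hf hφ hf0
    rwa [hX] at h
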